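/- All Lie superalgebras are finite-dimensional over $\mathbb{C}$; $[L,L]$ is denoted $L^2$, ideals are graded, isomorphisms preserve the $\mathbb{Z}_2$-grading, and the nilradical of a Lie superalgebra is its largest nilpotent ideal (the sum of all its nilpotent ideals). Let $k,p\ge 0$ and let $n_1,\dots,n_k,m_1,\dots,m_p\ge 1$ be integers. Put $N_j=n_1+\cdots+n_j$ and $M_j=m_1+\cdots+m_j$ (so $N_0=M_0=0$). The model nilpotent Lie superalgebra $N(n_1,\dots,n_k,1\mid m_1,\dots,m_p)$ has even basis vectors $x_1,\dots,x_{N_k+1}$ and odd basis vectors $y_1,\dots,y_{M_p}$, and its only non-zero brackets of basis vectors are $$[x_1,x_{N_j+i}]=-[x_{N_j+i},x_1]=x_{N_j+i+1}\quad(0\le j\le k-1,\ 2\le i\le n_{j+1}),$$ $$[x_1,y_{M_j+i}]=-[y_{M_j+i},x_1]=y_{M_j+i+1}\quad(0\le j\le p-1,\ 1\le i\le m_{j+1}-1).$$ The Lie superalgebra $SN(n_1,\dots,n_k,1\mid m_1,\dots,m_p)$ has the basis above together with $k+1+p$ further even basis vectors $t_1,\dots,t_{k+1},t'_1,\dots,t'_p$;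 its only non-zero brackets of basis vectors are those above and $$[t_1,x_i]=-[x_i,t_1]=i\,x_i\quad(1\le i\le N_k+1),\qquad [t_1,y_i]=-[y_i,t_1]=i\,y_i\quad(1\le i\le M_p),$$ $$[t_{j+2},x_{N_j+i}]=-[x_{N_j+i},t_{j+2}]=x_{N_j+i}\quad(0\le j\le k-1,\ 2\le i\le n_{j+1}+1),$$ $$[t'_{j+1},y_{M_j+i}]=-[y_{M_j+i},t'_{j+1}]=y_{M_j+i}\quad(0\le j\le p-1,\ 1\le i\le m_{j+1}).$$ **Theorem 4.1.** Let $L$ be a complex solvable Lie superalgebra such that $L^2$ is nilpotent and the nilradical of $L$ is isomorphic to $N(n_1,\dots,n_k,1\mid m_1,\dots,m_p)$. Suppose that $L$ has maximal dimension among all Lie superalgebras with these properties, for the given $n_1,\dots,n_k,m_1,\dots,m_p$. Then $L$ is isomorphic to $SN(n_1,\dots,n_k,1\mid m_1,\dots,m_p)$. -/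

import Mathlib

universe u v

/-- A complex Lie superalgebra with underlying vector space `V`: a decomposition of `V` into an
even part `part 0` and an odd part `part 1`, and an even bilinear bracket satisfying super
skew-symmetry and the super Jacobi identity on homogeneous elements. -/
structure LieSuperalgebra (V : Type u) [AddCommGroup V] [Module ℂ V] where
  part : ZMod 2 → Submodule ℂ V
  isCompl : IsCompl (part 0) (part 1)
  bracket : V →ₗ[ℂ] V →ₗ[ℂ] V
  bracket_mem : ∀ (i j : ZMod 2) (x y : V), x ∈ part i → y ∈ part j → bracket x y ∈ part (i + j)
  skew : ∀ (i j : ZMod 2) (x y : V), x ∈ part i → y ∈ part j →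
    bracket x y = -((-1 : ℂ) ^ (i.val * j.val) • bracket y x)
  jacobi : ∀ (i j l : ZMod 2) (x y z : V), x ∈ part i → y ∈ part j → z ∈ part l →
    (-1 : ℂ) ^ (l.val * i.val) • bracket x (bracket y z)
      + (-1 : ℂ) ^ (i.val * j.val) • bracket y (bracket z x)
      + (-1 : ℂ) ^ (j.val * l.val) • bracket z (bracket x y) = 0

namespace LieSuperalgebra

variable {V : Type u} [AddCommGroup V] [Module ℂ V] {W : Type v} [AddCommGroup W] [Module ℂ W]

/-- Isomorphism of Lie superalgebras: a linear bijection that respects the grading and the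
bracket. -/
def IsIsomorphic (A : LieSuperalgebra V) (B : LieSuperalgebra W) : Prop :=
  ∃ e : V ≃ₗ[ℂ] W,
    (∀ (i : ZMod 2) (x : V), x ∈ A.part i ↔ e x ∈ B.part i) ∧
    ∀ x y : V, e (A.bracket x y) = B.bracket (e x) (e y)

/-- The descending central sequence `S, [S, S], [[S, S], S], …` of a subspace `S` (used for
subspaces closed under the bracket), where `[U, U']` is the span of all `[u, u']`. -/
def lowerCentral (A : LieSuperalgebra V) (S : Submodule ℂ V) : ℕ → Submodule ℂ V
  | 0 => S
  | r + 1 => Submodule.map₂ A.bracket (lowerCentral A S r) S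

/-- The derived sequence of the whole superalgebra. -/
def derived (A : LieSuperalgebra V) : ℕ → Submodule ℂ V
  | 0 => ⊤
  | r + 1 => Submodule.map₂ A.bracket (derived A r) (derived A r)

/-- The subspace `S` (closed under the bracket) is nilpotent as a Lie superalgebra. -/
def IsNilpotentOn (A : LieSuperalgebra V) (S : Submodule ℂ V) : Prop :=
  ∃ r : ℕ, A.lowerCentral S r = ⊥

def IsSolvable (A : LieSuperalgebra V) : Prop :=
  ∃ r : ℕ, A.derived r = ⊥

/-- The square `L² = [L, L]`. -/
def square (A : LieSuperalgebra V) : Submodule ℂ V :=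
  Submodule.map₂ A.bracket ⊤ ⊤

/-- (Graded, two-sided) ideals. -/
structure IsIdeal (A : LieSuperalgebra V) (I : Submodule ℂ V) : Prop where
  graded : I ≤ (I ⊓ A.part 0) ⊔ (I ⊓ A.part 1)
  left : ∀ x y : V, y ∈ I → A.bracket x y ∈ I
  right : ∀ x y : V, x ∈ I → A.bracket x y ∈ I

/-- The nilradical: the sum of all nilpotent ideals, that is, in finite dimension, the largest
nilpotent ideal. -/
def nilradical (A : LieSuperalgebra V) : Submodule ℂ V :=
  sSup {I | A.IsIdeal I ∧ A.IsNilpotentOn I}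

theorem nilradical_isIdeal (A : LieSuperalgebra V) : A.IsIdeal A.nilradical := by
  refine ⟨?_, ?_, ?_⟩
  · refine sSup_le fun I hI => hI.1.graded.trans ?_
    have h : I ≤ A.nilradical := le_sSup hI
    exact sup_le_sup (inf_le_inf_right _ h) (inf_le_inf_right _ h)
  · intro x y hy
    have h : A.nilradical ≤ A.nilradical.comap (A.bracket x) := by
      refine sSup_le fun I hI z hz => ?_
      exact (le_sSup hI : I ≤ A.nilradical) (hI.1.left x z hz)
    exact h hy
  · intro x y hx
    have h : A.nilradical ≤ A.nilradical.comap (A.bracket.flip y) := by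
      refine sSup_le fun I hI z hz => ?_
      exact (le_sSup hI : I ≤ A.nilradical) (hI.1.right z y hz)
    exact h hx

/-- An ideal, viewed as a Lie superalgebra with the induced grading and bracket. -/
def ofIdeal (A : LieSuperalgebra V) (I : Submodule ℂ V) (hI : A.IsIdeal I) :
    LieSuperalgebra I where
  part i := (A.part i).comap I.subtype
  isCompl := by
    refine IsCompl.of_eq ?_ ?_
    · refine (Submodule.eq_bot_iff _).2 fun x hx => ?_
      have h0 : (x : V) ∈ A.part 0 ⊓ A.part 1 := ⟨hx.1, hx.2⟩
      rw [A.isCompl.inf_eq_bot] at h0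
      exact Subtype.ext ((Submodule.mem_bot ℂ).1 h0)
    · refine (Submodule.eq_top_iff').2 fun x => ?_
      obtain ⟨a, ha, b, hb, hab⟩ := Submodule.mem_sup.1 (hI.graded x.2)
      exact Submodule.mem_sup.2 ⟨⟨a, ha.1⟩, ha.2, ⟨b, hb.1⟩, hb.2, Subtype.ext hab⟩
  bracket := LinearMap.mk₂ ℂ (fun x y => ⟨A.bracket x y, hI.left x y y.2⟩)
    (fun x x' y => Subtype.ext (by simp)) (fun c x y => Subtype.ext (by simp))
    (fun x y y' => Subtype.ext (by simp)) (fun c x y => Subtype.ext (by simp))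
  bracket_mem i j x y hx hy := A.bracket_mem i j x y hx hy
  skew i j x y hx hy := Subtype.ext (A.skew i j x y hx hy)
  jacobi i j l x y z hx hy hz := Subtype.ext (A.jacobi i j l x y z hx hy hz)

/-- The bilinear bracket on the space with basis `ι` whose products of basis vectors are given by
a table. -/
noncomputable def tableBracket {ι : Type} (tab : ι → ι → (ι →₀ ℂ)) :
    (ι →₀ ℂ) →ₗ[ℂ] (ι →₀ ℂ) →ₗ[ℂ] (ι →₀ ℂ) :=
  Finsupp.linearCombination ℂ fun a => Finsupp.linearCombination ℂ (tab a)

theorem tableBracket_single {ι : Type} (tab : ι → ι → (ι →₀ ℂ)) (a b : ι) (r s : ℂ) :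
    tableBracket tab (Finsupp.single a r) (Finsupp.single b s) = (r * s) • tab a b := by
  simp [tableBracket, smul_smul]

/-- Induction over the homogeneous vectors of one parity. -/
theorem supported_ind {ι : Type} {s : Set ι} {P : (ι →₀ ℂ) → Prop} (h0 : P 0)
    (hadd : ∀ x y, P x → P y → P (x + y)) (hsmul : ∀ (c : ℂ) x, P x → P (c • x))
    (hs : ∀ a ∈ s, P (Finsupp.single a 1)) (x : ι →₀ ℂ) (hx : x ∈ Finsupp.supported ℂ ℂ s) :
    P x := by
  rw [Finsupp.supported_eq_span_single] at hx
  induction hx using Submodule.span_induction with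
  | mem x h => obtain ⟨a, ha, rfl⟩ := h; exact hs a ha
  | zero => exact h0
  | add x y _ _ h1 h2 => exact hadd x y h1 h2
  | smul c x _ h => exact hsmul c x h

/-- The Lie superalgebra with homogeneous basis `ι`, where the basis vector `a` has parity
`par a`, and with the given table of products of basis vectors. -/
noncomputable def ofTable {ι : Type} (par : ι → ZMod 2) (tab : ι → ι → (ι →₀ ℂ))
    (hmem : ∀ a b, tab a b ∈ Finsupp.supported ℂ ℂ {c | par c = par a + par b})
    (hskew : ∀ a b, tab a b = -((-1 : ℂ) ^ ((par a).val * (par b).val) • tab b a))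
    (hjac : ∀ a b c,
      (-1 : ℂ) ^ ((par c).val * (par a).val) • tableBracket tab (Finsupp.single a 1) (tab b c)
      + (-1 : ℂ) ^ ((par a).val * (par b).val) • tableBracket tab (Finsupp.single b 1) (tab c a)
      + (-1 : ℂ) ^ ((par b).val * (par c).val) • tableBracket tab (Finsupp.single c 1) (tab a b)
        = 0) :
    LieSuperalgebra (ι →₀ ℂ) where
  part i := Finsupp.supported ℂ ℂ {a | par a = i}
  isCompl := by
    refine IsCompl.of_eq ?_ ?_
    · rw [← Finsupp.supported_inter]
      refine Eq.trans (congrArg _ ?_) Finsupp.supported_empty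
      ext a
      simp only [Set.mem_inter_iff, Set.mem_ofPred_eq, Set.mem_empty_iff_false, iff_false, not_and]
      intro h
      rw [h]
      decide
    · rw [← Finsupp.supported_union]
      refine Eq.trans (congrArg _ ?_) Finsupp.supported_univ
      ext a
      simp only [Set.mem_union, Set.mem_ofPred_eq, Set.mem_univ, iff_true]
      generalize par a = q
      revert q
      decide
  bracket := tableBracket tab
  bracket_mem i j x y hx hy := by
    refine supported_ind (P := fun x => tableBracket tab x y ∈ _) (by simp)
      (fun _ _ h1 h2 => by simpa using Submodule.add_mem _ h1 h2)
      (fun c _ h => by simpa using Submodule.smul_mem _ c h) (fun a ha => ?_) x hx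
    refine supported_ind (P := fun y => tableBracket tab (Finsupp.single a 1) y ∈ _) (by simp)
      (fun _ _ h1 h2 => by simpa using Submodule.add_mem _ h1 h2)
      (fun c _ h => by simpa using Submodule.smul_mem _ c h) (fun b hb => ?_) y hy
    have h := hmem a b
    rw [Set.mem_ofPred_eq] at ha hb
    rw [ha, hb] at h
    simpa [tableBracket_single] using h
  skew i j x y hx hy := by
    refine supported_ind (P := fun x => tableBracket tab x y =
      -((-1 : ℂ) ^ (i.val * j.val) • tableBracket tab y x)) (by simp)
      (fun _ _ h1 h2 => by simp only [map_add, LinearMap.add_apply, h1, h2, smul_add]; abel)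
      (fun c _ h => by
        simp only [map_smul, LinearMap.smul_apply, h, smul_neg, smul_comm c]) (fun a ha => ?_) x hx
    refine supported_ind (P := fun y => tableBracket tab (Finsupp.single a 1) y =
      -((-1 : ℂ) ^ (i.val * j.val) • tableBracket tab y (Finsupp.single a 1))) (by simp)
      (fun _ _ h1 h2 => by simp only [map_add, LinearMap.add_apply, h1, h2, smul_add]; abel)
      (fun c _ h => by
        simp only [map_smul, LinearMap.smul_apply, h, smul_neg, smul_comm c]) (fun b hb => ?_) y hy
    have h := hskew a b
    rw [Set.mem_ofPred_eq] at ha hb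
    rw [ha, hb] at h
    simpa [tableBracket_single] using h
  jacobi i j l x y z hx hy hz := by
    have key : ∀ (r s t : ℂ) (T : (ι →₀ ℂ) → (ι →₀ ℂ) → (ι →₀ ℂ) → (ι →₀ ℂ)),
        (∀ x y z, T x y z = r • tableBracket tab x (tableBracket tab y z)
          + s • tableBracket tab y (tableBracket tab z x)
          + t • tableBracket tab z (tableBracket tab x y)) →
        (∀ x x' y z, T (x + x') y z = T x y z + T x' y z) ∧
        (∀ x y y' z, T x (y + y') z = T x y z + T x y' z) ∧
        (∀ x y z z', T x y (z + z') = T x y z + T x y z') ∧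
        (∀ (c : ℂ) x y z, T (c • x) y z = c • T x y z) ∧
        (∀ (c : ℂ) x y z, T x (c • y) z = c • T x y z) ∧
        (∀ (c : ℂ) x y z, T x y (c • z) = c • T x y z) ∧
        (∀ y z, T 0 y z = 0) ∧ (∀ x z, T x 0 z = 0) ∧ (∀ x y, T x y 0 = 0) := by
      intro r s t T hT
      refine ⟨?_, ?_, ?_, ?_, ?_, ?_, ?_, ?_, ?_⟩ <;> intros <;>
        simp only [hT, map_add, LinearMap.add_apply, map_smul, LinearMap.smul_apply, smul_add,
          map_zero, LinearMap.zero_apply, smul_zero, add_zero] <;> first | done | abel1 | module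
    obtain ⟨T, hT⟩ : ∃ T : (ι →₀ ℂ) → (ι →₀ ℂ) → (ι →₀ ℂ) → (ι →₀ ℂ), ∀ x y z, T x y z =
        (-1 : ℂ) ^ (l.val * i.val) • tableBracket tab x (tableBracket tab y z)
        + (-1 : ℂ) ^ (i.val * j.val) • tableBracket tab y (tableBracket tab z x)
        + (-1 : ℂ) ^ (j.val * l.val) • tableBracket tab z (tableBracket tab x y) :=
      ⟨_, fun _ _ _ => rfl⟩
    obtain ⟨a1, a2, a3, s1, s2, s3, z1, z2, z3⟩ := key _ _ _ T hT
    rw [← hT]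
    refine supported_ind (P := fun x => T x y z = 0) (z1 y z)
      (fun u v hu hv => by rw [a1, hu, hv, add_zero])
      (fun c u hu => by rw [s1, hu, smul_zero]) (fun a ha => ?_) x hx
    refine supported_ind (P := fun y => T _ y z = 0) (z2 _ z)
      (fun u v hu hv => by rw [a2, hu, hv, add_zero])
      (fun c u hu => by rw [s2, hu, smul_zero]) (fun b hb => ?_) y hy
    refine supported_ind (P := fun z => T _ _ z = 0) (z3 _ _)
      (fun u v hu hv => by rw [a3, hu, hv, add_zero])
      (fun c u hu => by rw [s3, hu, smul_zero]) (fun d hd => ?_) z hz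
    rw [hT]
    have h := hjac a b d
    rw [Set.mem_ofPred_eq] at ha hb hd
    rw [ha, hb, hd] at h
    simpa [tableBracket_single] using h

end LieSuperalgebra

namespace ModelNilpotent

open LieSuperalgebra

variable {k p : ℕ}

/-- The basis of the model nilpotent superalgebra with blocks of sizes `n 0, …, n (k-1)` (even)
and `m 0, …, m (p-1)` (odd). In the linear numbering `x_1, x_2, …`, `y_1, y_2, …` of the basis,
`x1` is `x_1`, and, with indices from `0`,
`x j i` is the vector `x_{n_0 + ⋯ + n_{j-1} + i + 2}`, the `i`-th vector of the `j`-th even block,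
`y j i` is the vector `y_{m_0 + ⋯ + m_{j-1} + i + 1}`, the `i`-th vector of the `j`-th odd block. -/
inductive NIdx (n : Fin k → ℕ) (m : Fin p → ℕ) : Type
  | x1 : NIdx n m
  | x (j : Fin k) (i : Fin (n j)) : NIdx n m
  | y (j : Fin p) (i : Fin (m j)) : NIdx n m

/-- The basis of the torus: `t1` is `t_1`, `t j` is the vector `t_{j+2}` that belongs to the `j`-th
even block, and `t' j` is the vector `t'_{j+1}` that belongs to the `j`-th odd block (indices `j`
from `0`). -/
inductive TIdx (k p : ℕ) : Type
  | t1 : TIdx k p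
  | t (j : Fin k) : TIdx k p
  | t' (j : Fin p) : TIdx k p

variable (n : Fin k → ℕ) (m : Fin p → ℕ)

def nParity : NIdx n m → ZMod 2
  | .x1 => 0
  | .x _ _ => 0
  | .y _ _ => 1

/-- The product of `x_1` with a basis vector: `x_1` moves each vector of a block to the next one of
the same block, and kills the last one. -/
noncomputable def shift : NIdx n m → (NIdx n m →₀ ℂ)
  | .x1 => 0
  | .x j i => if h : i.val + 1 < n j then Finsupp.single (.x j ⟨i.val + 1, h⟩) 1 else 0
  | .y j i => if h : i.val + 1 < m j then Finsupp.single (.y j ⟨i.val + 1, h⟩) 1 else 0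

/-- The products of the basis vectors of the model nilpotent superalgebra. -/
noncomputable def nTable : NIdx n m → NIdx n m → (NIdx n m →₀ ℂ)
  | .x1, b => shift n m b
  | .x j i, .x1 => -shift n m (.x j i)
  | .y j i, .x1 => -shift n m (.y j i)
  | _, _ => 0

/-- The eigenvalues of the torus: `[s, a] = weight s a • a` for `s` in the basis of the torus and
`a` in the basis of the model nilpotent superalgebra. -/
noncomputable def weight : TIdx k p → NIdx n m → ℂ
  | .t1, .x1 => 1
  | .t1, .x j i => (∑ l ∈ Finset.Iio j, n l : ℕ) + (i.val : ℂ) + 2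
  | .t1, .y j i => (∑ l ∈ Finset.Iio j, m l : ℕ) + (i.val : ℂ) + 1
  | .t j, .x j' _ => if j = j' then 1 else 0
  | .t' j, .y j' _ => if j = j' then 1 else 0
  | _, _ => 0

def snParity : NIdx n m ⊕ TIdx k p → ZMod 2
  | .inl a => nParity n m a
  | .inr _ => 0

/-- The products of the basis vectors of the solvable extension: the products of the model
nilpotent superalgebra, `[s, a] = -[a, s] = weight s a • a`, and an abelian torus. -/
noncomputable def snTable :
    NIdx n m ⊕ TIdx k p → NIdx n m ⊕ TIdx k p → ((NIdx n m ⊕ TIdx k p) →₀ ℂ)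
  | .inl a, .inl b => (nTable n m a b).mapDomain Sum.inl
  | .inr s, .inl a => Finsupp.single (.inl a) (weight n m s a)
  | .inl a, .inr s => -Finsupp.single (.inl a) (weight n m s a)
  | .inr _, .inr _ => 0

theorem nTable_skew (a b : NIdx n m) :
    nTable n m a b =
      -((-1 : ℂ) ^ ((nParity n m a).val * (nParity n m b).val) • nTable n m b a) := by
  rcases a with _ | ⟨j, i⟩ | ⟨j, i⟩ <;> rcases b with _ | ⟨j', i'⟩ | ⟨j', i'⟩ <;>
    simp [nTable, shift, nParity]

theorem nTable_mem (a b : NIdx n m) : nTable n m a b ∈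
    Finsupp.supported ℂ ℂ {c | nParity n m c = nParity n m a + nParity n m b} := by
  have hs : ∀ b, shift n m b ∈ Finsupp.supported ℂ ℂ {c | nParity n m c = nParity n m b} := by
    rintro (_ | ⟨j, i⟩ | ⟨j, i⟩)
    · exact Submodule.zero_mem _
    · simp only [shift]
      split_ifs
      · exact Finsupp.single_mem_supported _ _ rfl
      · exact Submodule.zero_mem _
    · simp only [shift]
      split_ifs
      · exact Finsupp.single_mem_supported _ _ rfl
      · exact Submodule.zero_mem _
  rcases a with _ | ⟨j, i⟩ | ⟨j, i⟩
  · simpa [nTable, nParity] using hs b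
  all_goals
    rcases b with _ | ⟨j', i'⟩ | ⟨j', i'⟩
    · simpa [nTable, nParity] using hs _
    all_goals exact Submodule.zero_mem _

theorem nTable_jacobi (a b c : NIdx n m) :
    (-1 : ℂ) ^ ((nParity n m c).val * (nParity n m a).val) •
        tableBracket (nTable n m) (Finsupp.single a 1) (nTable n m b c)
      + (-1 : ℂ) ^ ((nParity n m a).val * (nParity n m b).val) •
        tableBracket (nTable n m) (Finsupp.single b 1) (nTable n m c a)
      + (-1 : ℂ) ^ ((nParity n m b).val * (nParity n m c).val) •
        tableBracket (nTable n m) (Finsupp.single c 1) (nTable n m a b) = 0 := by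
  rcases a with _ | ⟨j, i⟩ | ⟨j, i⟩ <;> rcases b with _ | ⟨j', i'⟩ | ⟨j', i'⟩ <;>
    rcases c with _ | ⟨j'', i''⟩ | ⟨j'', i''⟩ <;> simp only [nTable, shift, nParity] <;>
    (try split_ifs) <;> simp [tableBracket_single, nTable]

/-- The model nilpotent Lie superalgebra `N(n_1, …, n_k, 1 | m_1, …, m_p)`. -/
noncomputable def modelN : LieSuperalgebra (NIdx n m →₀ ℂ) :=
  ofTable (nParity n m) (nTable n m) (nTable_mem n m) (nTable_skew n m) (nTable_jacobi n m)

theorem snTable_mem (a b : NIdx n m ⊕ TIdx k p) : snTable n m a b ∈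
    Finsupp.supported ℂ ℂ {c | snParity n m c = snParity n m a + snParity n m b} := by
  rcases a with a | s <;> rcases b with b | s'
  · have h := nTable_mem n m a b
    rw [Finsupp.mem_supported] at h ⊢
    classical
    intro c hc
    obtain ⟨d, hd, rfl⟩ := Finset.mem_image.1 (Finsupp.mapDomain_support hc)
    exact h hd
  · exact Submodule.neg_mem _ (Finsupp.single_mem_supported _ _ (by simp [snParity]))
  · exact Finsupp.single_mem_supported _ _ (by simp [snParity])
  · exact Submodule.zero_mem _

theorem snTable_skew (a b : NIdx n m ⊕ TIdx k p) : snTable n m a b =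
    -((-1 : ℂ) ^ ((snParity n m a).val * (snParity n m b).val) • snTable n m b a) := by
  rcases a with a | s <;> rcases b with b | s'
  · have h := congrArg (Finsupp.lmapDomain ℂ ℂ (Sum.inl : _ → NIdx n m ⊕ TIdx k p))
      (nTable_skew n m a b)
    rwa [map_neg, map_smul] at h
  · simp [snTable, snParity]
  · simp [snTable, snParity]
  · simp [snTable, snParity]

theorem snTable_inl (a : NIdx n m) (f : NIdx n m →₀ ℂ) :
    tableBracket (snTable n m) (Finsupp.single (Sum.inl a : NIdx n m ⊕ TIdx k p) 1)
      (f.mapDomain Sum.inl) =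
    Finsupp.lmapDomain ℂ ℂ Sum.inl (tableBracket (nTable n m) (Finsupp.single a 1) f) := by
  induction f using Finsupp.induction_linear with
  | zero => simp
  | add f g hf hg => rw [Finsupp.mapDomain_add, map_add, hf, hg, map_add, map_add]
  | single b r =>
    rw [Finsupp.mapDomain_single, tableBracket_single, tableBracket_single, map_smul]
    rfl

theorem snTable_jacobi (a b c : NIdx n m ⊕ TIdx k p) :
    (-1 : ℂ) ^ ((snParity n m c).val * (snParity n m a).val) •
        tableBracket (snTable n m) (Finsupp.single a 1) (snTable n m b c)
      + (-1 : ℂ) ^ ((snParity n m a).val * (snParity n m b).val) •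
        tableBracket (snTable n m) (Finsupp.single b 1) (snTable n m c a)
      + (-1 : ℂ) ^ ((snParity n m b).val * (snParity n m c).val) •
        tableBracket (snTable n m) (Finsupp.single c 1) (snTable n m a b) = 0 := by
  have hs : ∀ (s : TIdx k p) (b : NIdx n m),
      tableBracket (snTable n m) (Finsupp.single (Sum.inr s) 1)
        ((shift n m b).mapDomain Sum.inl) =
      (weight n m s .x1 + weight n m s b) • (shift n m b).mapDomain Sum.inl := by
    intro s b
    rcases b with _ | ⟨j, i⟩ | ⟨j, i⟩
    · simp [shift]
    all_goals
      simp only [shift]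
      split_ifs
      · rw [Finsupp.mapDomain_single, tableBracket_single]
        simp only [snTable, one_smul, Finsupp.smul_single, smul_eq_mul, mul_one]
        congr 1
        rcases s with _ | q | q <;> simp [weight]
        ring
      · simp
  have hw : ∀ (s : TIdx k p) (a b : NIdx n m),
      tableBracket (snTable n m) (Finsupp.single (Sum.inr s) 1)
        ((nTable n m a b).mapDomain Sum.inl) =
      (weight n m s a + weight n m s b) • (nTable n m a b).mapDomain Sum.inl := by
    intro s a b
    have hneg : ∀ f : NIdx n m →₀ ℂ, (-f).mapDomain (Sum.inl : _ → NIdx n m ⊕ TIdx k p) =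
        -f.mapDomain Sum.inl := fun f => map_neg (Finsupp.lmapDomain ℂ ℂ _) f
    rcases a with _ | ⟨j, i⟩ | ⟨j, i⟩
    · exact hs s b
    all_goals
      rcases b with _ | ⟨j', i'⟩ | ⟨j', i'⟩
      · simp only [nTable, hneg, map_neg, hs, smul_neg, add_comm (weight n m s .x1)]
      all_goals simp [nTable]
  have hsk : ∀ a b : NIdx n m, (nTable n m a b).mapDomain (Sum.inl : _ → NIdx n m ⊕ TIdx k p) =
      -((-1 : ℂ) ^ ((nParity n m a).val * (nParity n m b).val) •
        (nTable n m b a).mapDomain Sum.inl) := by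
    intro a b
    have h := congrArg (Finsupp.lmapDomain ℂ ℂ (Sum.inl : _ → NIdx n m ⊕ TIdx k p))
      (nTable_skew n m a b)
    rwa [map_neg, map_smul] at h
  rcases a with a | s <;> rcases b with b | s' <;> rcases c with c | s''
  · have h := congrArg (Finsupp.lmapDomain ℂ ℂ (Sum.inl : _ → NIdx n m ⊕ TIdx k p))
      (nTable_jacobi n m a b c)
    simp only [snTable, snParity, snTable_inl]
    simpa only [map_add, map_smul, map_zero] using h
  · simp only [snTable, snParity, hw, map_neg, tableBracket_single, ZMod.val_zero, zero_mul,
      mul_zero, pow_zero]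
    rw [hsk b a, mul_comm (nParity n m b).val]
    rcases neg_one_pow_eq_or ℂ ((nParity n m a).val * (nParity n m b).val) with h | h <;>
      rw [h] <;> module
  · simp only [snTable, snParity, hw, map_neg, tableBracket_single, ZMod.val_zero, zero_mul,
      mul_zero, pow_zero]
    rw [hsk a c, mul_comm (nParity n m c).val]
    rcases neg_one_pow_eq_or ℂ ((nParity n m a).val * (nParity n m c).val) with h | h <;>
      rw [h] <;> module
  · simp only [snTable, snParity, map_neg, map_zero, tableBracket_single, ZMod.val_zero, zero_mul,
      mul_zero, pow_zero, smul_neg, Finsupp.smul_single, smul_eq_mul]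
    simp [mul_comm]
  · simp only [snTable, snParity, hw, map_neg, tableBracket_single, ZMod.val_zero, zero_mul,
      mul_zero, pow_zero]
    rw [hsk c b, mul_comm (nParity n m c).val]
    rcases neg_one_pow_eq_or ℂ ((nParity n m b).val * (nParity n m c).val) with h | h <;>
      rw [h] <;> module
  all_goals
    simp only [snTable, snParity, map_neg, map_zero, tableBracket_single, ZMod.val_zero, zero_mul,
      mul_zero, pow_zero, smul_neg, Finsupp.smul_single, smul_eq_mul]
    simp [mul_comm]

/-- The solvable Lie superalgebra `SN(n_1, …, n_k, 1 | m_1, …, m_p)`. -/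
noncomputable def modelSN : LieSuperalgebra ((NIdx n m ⊕ TIdx k p) →₀ ℂ) :=
  ofTable (snParity n m) (snTable n m) (snTable_mem n m) (snTable_skew n m) (snTable_jacobi n m)

/-- `A` is a solvable Lie superalgebra whose square is nilpotent and whose nilradical is isomorphic
to the model nilpotent superalgebra. -/
def IsSolvableExtension {V : Type u} [AddCommGroup V] [Module ℂ V] (A : LieSuperalgebra V) :
    Prop :=
  A.IsSolvable ∧ A.IsNilpotentOn A.square ∧
    IsIsomorphic (A.ofIdeal A.nilradical A.nilradical_isIdeal) (modelN n m)

end ModelNilpotent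

/-! Write N for the nilradical, embedded by `NilradicalModel`. Since L² is nilpotent, L² ⊆ N. Every
odd z also lies in N: right multiplication satisfies R_z² = ½ R_{[z,z]} with [z,z] ∈ N, so R_z is
nilpotent on N and N + ℂz is again a nilpotent ideal (`odd_le_nilradical`). Modulo N, therefore, L
is represented by even elements, which act on N by even derivations.

Consider the action of L on N/N², a space of dimension k+1+p. Elements of N act by zero, and the
action is commutative because [L,L] ⊆ N. If an even element acts nilpotently on N/N², its
generalized 0-eigenspace in N is a subalgebra that maps onto N/N², hence is N, and the element
belongs to the nilradical. So L/N embeds as a commuting family without nonzero nilpotent members,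
whose dimension is at most k+1+p. The superalgebra SN itself satisfies the hypotheses
(`modelSN_isSolvableExtension`), so maximality forces equality. Then N/N² has a homogeneous basis of
common eigenvectors, and every system of eigenvalues occurs (`exists_common_eigenbasis`,
`exists_weight_basis`).

Choose an even h with eigenvalue 1 on an eigenvector whose x_1-coordinate is nonzero, and with
distinct positive integer multiples of i on the others. Lift the eigenvectors to homogeneous
generalized eigenvectors u_s of ad h in N. With x the lift for the eigenvalue 1, the vectors (ad
x)^r u_s have eigenvalues r + c_s i. These are distinct from each other and from 1. Comparing
eigenvalues in the identity `smul_modelN_bracket` shows that the members of these chains bracket to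
zero with each other. Hence the chains form a basis of N that multiplies as in some model. The ranks
of the powers of ad x on the even and odd parts determine the chain lengths up to order, so after a
permutation the lengths are n and m (`exists_perm_lengths`).

All eigenvalues of ad h on N are nonzero, so ad h is invertible there. Any even element can thus be
corrected by an element of N so that it commutes with h. Corrected elements with the standard
weights commute pairwise: their brackets lie in N and are killed by ad h. They are also diagonal on
the chains, because ad h has simple spectrum on N (`exists_torus`). The chains and this torus
multiply by the table of SN, and the weights on the generators form an invertible matrix, so
together they are a basis of L. -/

namespace LieSuperalgebra

/-! ### Ideals, the nilradical, and the action of even and odd elements -/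

variable {V : Type u} [AddCommGroup V] [Module ℂ V] (A : LieSuperalgebra V)

theorem zmod_two_cases (j : ZMod 2) : j = 0 ∨ j = 1 := by
  revert j
  decide

theorem neg_one_pow_smul_mem_iff {P : Submodule ℂ V} (r : ℕ) {x : V} :
    (-1 : ℂ) ^ r • x ∈ P ↔ x ∈ P := by
  rcases neg_one_pow_eq_or ℂ r with h | h <;> simp [h]

theorem exists_add_eq (x : V) : ∃ a ∈ A.part 0, ∃ b ∈ A.part 1, a + b = x := by
  have h : x ∈ A.part 0 ⊔ A.part 1 := by rw [A.isCompl.sup_eq_top]; trivial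
  exact Submodule.mem_sup.1 h

theorem homogeneous_induction {P : V → Prop} (hadd : ∀ x y, P x → P y → P (x + y))
    (h : ∀ (i : ZMod 2) (x : V), x ∈ A.part i → P x) (x : V) : P x := by
  obtain ⟨a, ha, b, hb, rfl⟩ := A.exists_add_eq x
  exact hadd a b (h 0 a ha) (h 1 b hb)

variable {A}

theorem IsIdeal.homogeneous_induction {I : Submodule ℂ V} (hI : A.IsIdeal I) {P : V → Prop}
    (hadd : ∀ x y, P x → P y → P (x + y))
    (h : ∀ (i : ZMod 2) (x : V), x ∈ I → x ∈ A.part i → P x) {x : V} (hx : x ∈ I) : P x := by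
  obtain ⟨a, ha, b, hb, rfl⟩ := Submodule.mem_sup.1 (hI.graded hx)
  exact hadd a b (h 0 a ha.1 ha.2) (h 1 b hb.1 hb.2)

variable (A)

theorem bracket_mem_of_swap {P : Submodule ℂ V} {i j : ZMod 2} {x y : V} (hx : x ∈ A.part i)
    (hy : y ∈ A.part j) (h : A.bracket y x ∈ P) : A.bracket x y ∈ P := by
  rw [A.skew i j x y hx hy]
  exact P.neg_mem ((neg_one_pow_smul_mem_iff _).2 h)

theorem isIdeal_top : A.IsIdeal ⊤ := by
  refine ⟨?_, fun _ _ _ => trivial, fun _ _ _ => trivial⟩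
  rw [top_inf_eq, top_inf_eq, A.isCompl.sup_eq_top]

variable {A}

/-- By Jacobi, [z,[a,b]] is up to signs a combination of [a,[b,z]] and [b,[z,a]], and both lie in
[I,J]. Jacobi is only available for homogeneous elements, hence the reduction `red`. -/
theorem IsIdeal.map₂ {I J : Submodule ℂ V} (hI : A.IsIdeal I) (hJ : A.IsIdeal J) :
    A.IsIdeal (Submodule.map₂ A.bracket I J) := by
  set K := Submodule.map₂ A.bracket I J
  have red : ∀ Q : Submodule ℂ V, (∀ (i j : ZMod 2) (a b : V), a ∈ I → a ∈ A.part i → b ∈ J →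
      b ∈ A.part j → A.bracket a b ∈ Q) → K ≤ Q := by
    intro Q h
    refine Submodule.map₂_le.2 fun a ha b hb => ?_
    refine hI.homogeneous_induction (P := fun a => A.bracket a b ∈ Q)
      (fun x y h1 h2 => by simpa using Q.add_mem h1 h2) (fun i a ha hai => ?_) ha
    exact hJ.homogeneous_induction (P := fun b => A.bracket a b ∈ Q)
      (fun x y h1 h2 => by simpa using Q.add_mem h1 h2) (fun j b hb hbj => h i j a b ha hai hb hbj)
      hb
  have hleft : ∀ (l i j : ZMod 2) (z a b : V), z ∈ A.part l → a ∈ I → a ∈ A.part i → b ∈ J →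
      b ∈ A.part j → A.bracket z (A.bracket a b) ∈ K := by
    intro l i j z a b hz ha hai hb hbj
    have h := A.jacobi l i j z a b hz hai hbj
    have h1 : A.bracket a (A.bracket b z) ∈ K :=
      Submodule.apply_mem_map₂ _ ha (hJ.right _ _ hb)
    have h2 : A.bracket b (A.bracket z a) ∈ K :=
      A.bracket_mem_of_swap hbj (A.bracket_mem _ _ _ _ hz hai)
        (Submodule.apply_mem_map₂ _ (hI.left _ _ ha) hb)
    rw [add_assoc, add_eq_zero_iff_eq_neg] at h
    rw [← neg_one_pow_smul_mem_iff, h]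
    exact K.neg_mem (K.add_mem ((neg_one_pow_smul_mem_iff _).2 h1)
      ((neg_one_pow_smul_mem_iff _).2 h2))
  refine ⟨?_, ?_, ?_⟩
  · refine red _ fun i j a b ha hai hb hbj => ?_
    have h1 : A.bracket a b ∈ K := Submodule.apply_mem_map₂ _ ha hb
    have h2 := A.bracket_mem i j a b hai hbj
    generalize i + j = q at h2
    fin_cases q
    · exact Submodule.mem_sup_left ⟨h1, h2⟩
    · exact Submodule.mem_sup_right ⟨h1, h2⟩
  · intro z x hx
    refine A.homogeneous_induction (P := fun z => A.bracket z x ∈ K)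
      (fun x y h1 h2 => by simpa using K.add_mem h1 h2) (fun l z hz => ?_) z
    exact red (K.comap (A.bracket z)) (fun i j a b ha hai hb hbj =>
      hleft l i j z a b hz ha hai hb hbj) hx
  · intro x z hx
    refine A.homogeneous_induction (P := fun z => A.bracket x z ∈ K)
      (fun x y h1 h2 => by simpa using K.add_mem h1 h2) (fun l z hz => ?_) z
    refine red (K.comap (A.bracket.flip z)) (fun i j a b ha hai hb hbj => ?_) hx
    show A.bracket (A.bracket a b) z ∈ K
    exact A.bracket_mem_of_swap (A.bracket_mem _ _ _ _ hai hbj) hz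
      (hleft l i j z a b hz ha hai hb hbj)

theorem IsIdeal.lowerCentral {I : Submodule ℂ V} (hI : A.IsIdeal I) (r : ℕ) :
    A.IsIdeal (A.lowerCentral I r) := by
  induction r with
  | zero => exact hI
  | succ r ih => exact ih.map₂ hI

variable (A)

theorem square_isIdeal : A.IsIdeal A.square := A.isIdeal_top.map₂ A.isIdeal_top

theorem bracket_mem_square (x y : V) : A.bracket x y ∈ A.square :=
  Submodule.apply_mem_map₂ _ trivial trivial

theorem square_le_nilradical (h : A.IsNilpotentOn A.square) : A.square ≤ A.nilradical :=
  le_sSup ⟨A.square_isIdeal, h⟩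

variable {A}

theorem IsIdeal.lowerCentral_le {I : Submodule ℂ V} (hI : A.IsIdeal I) (r : ℕ) :
    A.lowerCentral I r ≤ I := by
  induction r with
  | zero => exact le_rfl
  | succ r ih => exact Submodule.map₂_le.2 fun a ha b _ => hI.right _ _ (ih ha)

theorem isSolvable_of_isNilpotentOn_square (h : A.IsNilpotentOn A.square) : A.IsSolvable := by
  obtain ⟨r, hr⟩ := h
  have key : ∀ s, A.derived (s + 1) ≤ A.lowerCentral A.square s := by
    intro s
    induction s with
    | zero => exact le_rfl
    | succ s ih =>
      exact Submodule.map₂_le_map₂ ih (ih.trans (A.square_isIdeal.lowerCentral_le s))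
  exact ⟨r + 1, le_bot_iff.1 ((key r).trans hr.le)⟩

/-- Right multiplication by an element of a nilpotent ideal is nilpotent on that ideal. -/
theorem IsNilpotentOn.flip_pow_eq_zero {I : Submodule ℂ V} (h : A.IsNilpotentOn I) :
    ∃ q, ∀ z ∈ I, ∀ a ∈ I, (A.bracket.flip z ^ q) a = 0 := by
  obtain ⟨r, hr⟩ := h
  refine ⟨r, fun z hz a ha => ?_⟩
  have key : ∀ s, (A.bracket.flip z ^ s) a ∈ A.lowerCentral I s := by
    intro s
    induction s with
    | zero => exact ha
    | succ s ih =>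
      rw [pow_succ', Module.End.mul_apply]
      exact Submodule.apply_mem_map₂ _ ih hz
  simpa [hr] using key r

/-- A homogeneous element whose right multiplication is nilpotent on a nilpotent ideal containing
the square belongs to the nilradical. -/
theorem mem_nilradical_of_flip_pow_eq_zero {I : Submodule ℂ V} (hI : A.IsIdeal I)
    (hnil : A.IsNilpotentOn I) (hsq : A.square ≤ I) {i : ZMod 2} {z : V} (hz : z ∈ A.part i)
    {Q : ℕ} (hQ : ∀ a ∈ I, (A.bracket.flip z ^ Q) a = 0) : z ∈ A.nilradical := by
  set J := I ⊔ Submodule.span ℂ {z}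
  have hIJ : I ≤ J := le_sup_left
  have hzJ : z ∈ J := Submodule.mem_sup_right (Submodule.mem_span_singleton_self z)
  have hJ : A.IsIdeal J := by
    refine ⟨?_, fun x y _ => hIJ (hsq (A.bracket_mem_square x y)),
      fun x y _ => hIJ (hsq (A.bracket_mem_square x y))⟩
    refine sup_le (hI.graded.trans (sup_le_sup (inf_le_inf_right _ hIJ) (inf_le_inf_right _ hIJ))) ?_
    rw [Submodule.span_singleton_le_iff_mem]
    fin_cases i
    · exact Submodule.mem_sup_left ⟨hzJ, hz⟩
    · exact Submodule.mem_sup_right ⟨hzJ, hz⟩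
  suffices h : A.IsNilpotentOn J from
    (le_sSup (a := J) (s := {I | A.IsIdeal I ∧ A.IsNilpotentOn I}) ⟨hJ, h⟩ : J ≤ _) hzJ
  -- Bracketing with J = I + ℂz either brackets with I, which moves down to the next central term of
  -- I, or applies R_z once more. After Q steps the second alternative gives zero.
  have step : ∀ s c, A.lowerCentral J s ≤ A.lowerCentral I c → ∀ q, A.lowerCentral J (s + q) ≤
      A.lowerCentral I (c + 1) ⊔ (A.lowerCentral I c).map (A.bracket.flip z ^ q) := by
    intro s c hsc q
    have hc := hI.lowerCentral c
    have hc1 := hI.lowerCentral (c + 1)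
    have hstab : ∀ q, (A.lowerCentral I c).map (A.bracket.flip z ^ q) ≤ A.lowerCentral I c := by
      intro q
      induction q with
      | zero => simp [Module.End.one_eq_id]
      | succ q ih =>
        rintro _ ⟨a, ha, rfl⟩
        rw [pow_succ', Module.End.mul_apply]
        exact hc.right _ _ (ih ⟨a, ha, rfl⟩)
    induction q with
    | zero => exact hsc.trans (by simp [Module.End.one_eq_id])
    | succ q ih =>
      refine Submodule.map₂_le.2 fun x hx y hy => ?_
      obtain ⟨y1, hy1, y2, hy2, rfl⟩ := Submodule.mem_sup.1 hy
      obtain ⟨t, rfl⟩ := Submodule.mem_span_singleton.1 hy2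
      obtain ⟨x1, hx1, x2, hx2, rfl⟩ := Submodule.mem_sup.1 (ih hx)
      have e : A.bracket (x1 + x2) (y1 + t • z) =
          (A.bracket x1 (y1 + t • z) + A.bracket x2 y1) + t • A.bracket x2 z := by
        simp only [map_add, LinearMap.add_apply, map_smul]; module
      rw [e]
      refine Submodule.add_mem_sup (Submodule.add_mem _ (hc1.right _ _ hx1)
        (Submodule.apply_mem_map₂ _ (hstab _ hx2) hy1)) (Submodule.smul_mem _ _ ?_)
      obtain ⟨a, ha, rfl⟩ := hx2
      exact ⟨a, ha, by rw [pow_succ', Module.End.mul_apply]; rfl⟩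
  have key : ∀ c, ∃ s, A.lowerCentral J s ≤ A.lowerCentral I c := by
    intro c
    induction c with
    -- The induction starts at 1: a single bracket of J already lies in L² ⊆ I.
    | zero => exact ⟨1, Submodule.map₂_le.2 fun a _ b _ => hsq (A.bracket_mem_square a b)⟩
    | succ c ih =>
      obtain ⟨s, hs⟩ := ih
      refine ⟨s + Q, (step s c hs Q).trans (sup_le le_rfl ?_)⟩
      rintro _ ⟨a, ha, rfl⟩
      rw [hQ a (hI.lowerCentral_le c ha)]
      exact zero_mem _
  obtain ⟨r, hr⟩ := hnil
  obtain ⟨s, hs⟩ := key r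
  exact ⟨s, le_bot_iff.1 (hs.trans hr.le)⟩

variable (A)

theorem flip_apply_of_even {x : V} (hx : x ∈ A.part 0) (y : V) :
    A.bracket y x = -A.bracket x y := by
  refine A.homogeneous_induction (P := fun y => A.bracket y x = -A.bracket x y)
    (fun a b h1 h2 => by simp [h1, h2, add_comm]) (fun j y hy => ?_) y
  rw [A.skew j 0 y x hy hx]
  simp

/-- Jacobi for the triple a, z, z: for odd z the two terms with a single z inside coincide instead
of cancelling, so twice the square of R_z is R_{[z,z]}. -/
theorem flip_odd_sq {z : V} (hz : z ∈ A.part 1) (a : V) :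
    A.bracket (A.bracket a z) z = (2⁻¹ : ℂ) • A.bracket a (A.bracket z z) := by
  refine A.homogeneous_induction
    (P := fun a => A.bracket (A.bracket a z) z = (2⁻¹ : ℂ) • A.bracket a (A.bracket z z))
    (fun a b h1 h2 => by simp [h1, h2]) (fun j a ha => ?_) a
  have h := A.jacobi j 1 1 a z z ha hz hz
  have h1 := A.skew (j + 1) 1 (A.bracket a z) z (A.bracket_mem _ _ _ _ ha hz) hz
  have h2 := A.skew 1 j z a hz ha
  obtain rfl | rfl : j = 0 ∨ j = 1 := zmod_two_cases j
  · simp only [zero_add, ZMod.val_one, ZMod.val_zero, mul_zero, mul_one, pow_zero,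
      pow_one, one_smul, neg_smul, neg_neg] at h h1 h2
    rw [h2, map_neg] at h
    rw [h1]
    linear_combination (norm := module) (-2⁻¹ : ℂ) • h
  · rw [show (1 + 1 : ZMod 2) = 0 from by decide] at h1
    simp only [ZMod.val_one, ZMod.val_zero, mul_one, pow_zero, pow_one, one_smul,
      neg_smul, neg_neg] at h h1 h2
    rw [h2] at h
    rw [h1]
    linear_combination (norm := module) (2⁻¹ : ℂ) • h

/-- The square [z,z] of an odd z lies in L² ⊆ N, where right multiplications are nilpotent, and R_z²
is half the right multiplication by [z,z]. Adjoining z to N therefore keeps the ideal nilpotent. -/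
theorem odd_le_nilradical (hsq : A.IsNilpotentOn A.square) (hnil : A.IsNilpotentOn A.nilradical) :
    A.part 1 ≤ A.nilradical := by
  intro z hz
  have hle := A.square_le_nilradical hsq
  obtain ⟨q, hq⟩ := hnil.flip_pow_eq_zero
  refine mem_nilradical_of_flip_pow_eq_zero A.nilradical_isIdeal hnil hle hz (Q := 2 * q) ?_
  intro a ha
  have h2 : A.bracket.flip z ^ 2 = (2⁻¹ : ℂ) • A.bracket.flip (A.bracket z z) := by
    ext b
    rw [pow_two]
    exact A.flip_odd_sq hz b
  rw [pow_mul, h2, smul_pow, LinearMap.smul_apply,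
    hq _ (hle (A.bracket_mem_square z z)) a ha, smul_zero]

/-- The Jacobi identity for two even elements: the adjoint action of an even element is an even
derivation, and brackets of even elements act by commutators. -/
theorem leibniz_of_even {x y : V} (hx : x ∈ A.part 0) (hy : y ∈ A.part 0) (z : V) :
    A.bracket (A.bracket x y) z =
      A.bracket x (A.bracket y z) - A.bracket y (A.bracket x z) := by
  refine A.homogeneous_induction (P := fun z => A.bracket (A.bracket x y) z =
      A.bracket x (A.bracket y z) - A.bracket y (A.bracket x z))
    (fun a b h1 h2 => by simp only [map_add, h1, h2]; abel) (fun j z hz => ?_) z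
  have h := A.jacobi 0 0 j x y z hx hy hz
  have h1 := A.flip_apply_of_even (A.bracket_mem 0 0 x y hx hy) z
  have h2 := A.flip_apply_of_even hx z
  simp [h1, h2] at h
  linear_combination (norm := module) -h

theorem derivation_of_even {x : V} (hx : x ∈ A.part 0) (y z : V) :
    A.bracket x (A.bracket y z) =
      A.bracket (A.bracket x y) z + A.bracket y (A.bracket x z) := by
  refine A.homogeneous_induction (P := fun y => A.bracket x (A.bracket y z) =
      A.bracket (A.bracket x y) z + A.bracket y (A.bracket x z))
    (fun a b h1 h2 => by simp only [map_add, LinearMap.add_apply, h1, h2]; abel)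
    (fun i y hy => ?_) y
  refine A.homogeneous_induction (P := fun z => A.bracket x (A.bracket y z) =
      A.bracket (A.bracket x y) z + A.bracket y (A.bracket x z))
    (fun a b h1 h2 => by simp only [map_add, h1, h2]; abel) (fun j z hz => ?_) z
  have h := A.jacobi 0 i j x y z hx hy hz
  have h1 := A.flip_apply_of_even hx z
  have h2 := A.skew j (0 + i) z (A.bracket x y) hz (A.bracket_mem 0 i x y hx hy)
  rw [h1, h2] at h
  simp [mul_comm j.val, smul_smul, ← pow_add, ← two_mul] at h
  linear_combination (norm := module) h

/-- Split a vector of parity i along the basis vectors of parity i and of parity i + 1. The second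
component lies in both parts, so it vanishes. -/
theorem span_even_eq_part {ι : Type*} {par : ι → ZMod 2} {b : ι → V}
    (hb : ∀ a, b a ∈ A.part (par a)) (htop : Submodule.span ℂ (Set.range b) = ⊤) (i : ZMod 2) :
    Submodule.span ℂ (b '' {a | par a = i}) = A.part i := by
  have hle : ∀ j, Submodule.span ℂ (b '' {a | par a = j}) ≤ A.part j := by
    intro j
    rw [Submodule.span_le]
    rintro _ ⟨a, ha, rfl⟩
    exact (show par a = j from ha) ▸ hb a
  refine le_antisymm (hle i) fun x hx => ?_
  have hx' : x ∈ Submodule.span ℂ (b '' {a | par a = i}) ⊔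
      Submodule.span ℂ (b '' {a | par a = i + 1}) := by
    rw [← Submodule.span_union, ← Set.image_union]
    have : {a | par a = i} ∪ {a | par a = i + 1} = Set.univ := by
      ext a
      simp only [Set.mem_union, Set.mem_ofPred_eq, Set.mem_univ, iff_true]
      generalize par a = q
      clear hx
      revert i q
      decide
    rw [this, Set.image_univ, htop]
    trivial
  obtain ⟨y, hy, z, hz, rfl⟩ := Submodule.mem_sup.1 hx'
  have hz1 := hle _ hz
  have hz2 : z ∈ A.part i := by simpa using (A.part i).sub_mem hx (hle _ hy)
  have hz0 : z = 0 := by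
    have h := A.isCompl.inf_eq_bot
    rw [← Submodule.mem_bot ℂ, ← h]
    fin_cases i
    · exact ⟨hz2, hz1⟩
    · exact ⟨hz1, hz2⟩
  rw [hz0, add_zero]
  exact hy

end LieSuperalgebra

/-! ### Linear algebra: independent families, generalized eigenspaces, chains -/

open Module

/-- A vector of one member of an independent family of subspaces is a multiple of the basis vector
in that member, if the basis vectors lie in distinct members. -/
theorem iSupIndep.exists_smul_eq_of_basis {ι κ K E : Type*} [Field K] [AddCommGroup E] [Module K E]
    {U : κ → Submodule K E} (hU : iSupIndep U) (b : Basis ι K E) {f : ι → κ}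
    (hf : Function.Injective f) (hb : ∀ a, b a ∈ U (f a)) {a : ι} {v : E} (hv : v ∈ U (f a)) :
    ∃ c : K, v = c • b a := by
  classical
  refine ⟨b.repr v a, ?_⟩
  rw [← sub_eq_zero]
  have h1 : v - b.repr v a • b a ∈ U (f a) :=
    Submodule.sub_mem _ hv (Submodule.smul_mem _ _ (hb a))
  have h2 : v - b.repr v a • b a ∈ ⨆ (j) (_ : j ≠ f a), U j := by
    have e : v - b.repr v a • b a = Finsupp.linearCombination K b ((b.repr v).erase a) := by
      conv_lhs => enter [1]; rw [← b.linearCombination_repr v]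
      conv_lhs => enter [1]; rw [← Finsupp.single_add_erase a (b.repr v)]
      rw [map_add, Finsupp.linearCombination_single, add_sub_cancel_left]
    rw [e, Finsupp.linearCombination_apply, Finsupp.sum]
    refine Submodule.sum_mem _ fun i hi => Submodule.smul_mem _ _ ?_
    have hia : i ≠ a := by
      rintro rfl
      simp at hi
    exact Submodule.mem_iSup_of_mem (f i)
      (Submodule.mem_iSup_of_mem (fun h => hia (hf h)) (hb i))
  exact Submodule.disjoint_def.1 (hU (f a)) _ h1 h2

/-- A member of an independent family is zero if other members of the family contain a spanning
set. -/
theorem iSupIndep.eq_zero_of_basis {ι κ K E : Type*} [Field K] [AddCommGroup E] [Module K E]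
    {U : κ → Submodule K E} (hU : iSupIndep U) {b : ι → E} {f : ι → κ}
    (hb : ∀ a, b a ∈ U (f a)) (hspan : Submodule.span K (Set.range b) = ⊤) {q : κ}
    (hq : ∀ a, f a ≠ q) {v : E} (hv : v ∈ U q) : v = 0 := by
  refine Submodule.disjoint_def.1 (hU q) _ hv ?_
  have h : (⊤ : Submodule K E) ≤ ⨆ (j) (_ : j ≠ q), U j := by
    rw [← hspan, Submodule.span_le]
    rintro _ ⟨a, rfl⟩
    exact Submodule.mem_iSup_of_mem (f a) (Submodule.mem_iSup_of_mem (hq a) (hb a))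
  exact h trivial

theorem pow_finrank_eq_zero_of_maxGenEigenspace {E : Type*} [AddCommGroup E] [Module ℂ E]
    [FiniteDimensional ℂ E] {f : End ℂ E} (h : f.maxGenEigenspace 0 = ⊤) :
    f ^ finrank ℂ E = 0 := by
  rw [End.maxGenEigenspace_eq_genEigenspace_finrank] at h
  refine LinearMap.ext fun y => ?_
  have hy : y ∈ f.genEigenspace 0 (finrank ℂ E) := by rw [h]; trivial
  rw [End.mem_genEigenspace_nat] at hy
  simpa using hy

/-- A commuting linear family of endomorphisms without nonzero nilpotent members, whose dimension
is at least that of the space it acts on, has a basis of common eigenvectors, and the eigenvalues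
can be prescribed. -/
theorem exists_common_eigenbasis {V W : Type*} [AddCommGroup V] [Module ℂ V] [AddCommGroup W]
    [Module ℂ W] [FiniteDimensional ℂ W] (M : V →ₗ[ℂ] End ℂ W)
    (hcomm : ∀ x y, Commute (M x) (M y)) (hnil : ∀ x, IsNilpotent (M x) → M x = 0)
    (hdim : finrank ℂ W ≤ finrank ℂ (LinearMap.range M)) :
    ∃ (w : Basis (Fin (finrank ℂ W)) ℂ W) (χ : V →ₗ[ℂ] (Fin (finrank ℂ W) → ℂ)),
      Function.Surjective χ ∧ (∀ x i, M x (w i) = χ x i • w i) ∧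
      ∀ F : End ℂ W, (∀ x, Commute F (M x)) → ∀ i, ∃ c : ℂ, F (w i) = c • w i := by
  set U : (V → ℂ) → Submodule ℂ W := fun χ => ⨅ x, (M x).maxGenEigenspace (χ x)
  have hU : iSupIndep U := End.independent_iInf_maxGenEigenspace_of_forall_mapsTo _
    fun x y μ => End.mapsTo_maxGenEigenspace_of_comm (hcomm y x) μ
  have htop : ⨆ χ, U χ = ⊤ :=
    End.iSup_iInf_maxGenEigenspace_eq_top_of_iSup_maxGenEigenspace_eq_top_of_commute _
      (fun x y _ => hcomm x y) fun x => End.iSup_maxGenEigenspace_eq_top _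
  let X := {χ // U χ ≠ ⊥}
  have : Fintype X := hU.fintypeNeBotOfFiniteDimensional
  have hadd : ∀ (χ : X) x y, χ.1 (x + y) = χ.1 x + χ.1 y := fun χ x y =>
    End.map_add_of_iInf_genEigenspace_ne_bot_of_commute M χ.1 _ χ.2 hcomm x y
  have hsmul : ∀ (χ : X) (c : ℂ) x, χ.1 (c • x) = c • χ.1 x := fun χ c x =>
    End.map_smul_of_iInf_genEigenspace_ne_bot M χ.1 _ χ.2 c x
  let d : V →ₗ[ℂ] (X → ℂ) :=
    { toFun := fun x χ => χ.1 x
      map_add' := fun x y => funext fun χ => hadd χ x y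
      map_smul' := fun c x => funext fun χ => hsmul χ c x }
  -- If all weights vanish at x, then `M x` has 0 as its only eigenvalue and is nilpotent, hence
  -- zero by `hnil`.
  have hker : LinearMap.ker d ≤ LinearMap.ker M := by
    intro x hx
    refine hnil x ?_
    have h0 : (M x).maxGenEigenspace 0 = ⊤ := by
      rw [eq_top_iff, ← htop]
      refine iSup_le fun χ => ?_
      by_cases hχ : U χ = ⊥
      · rw [hχ]; exact bot_le
      · have : χ x = 0 := congrFun (LinearMap.mem_ker.1 hx) ⟨χ, hχ⟩
        rw [← this]
        exact iInf_le _ x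
    exact ⟨finrank ℂ W, pow_finrank_eq_zero_of_maxGenEigenspace h0⟩
  have hcard : Fintype.card X ≤ finrank ℂ W := hU.subtype_ne_bot_le_finrank
  -- `M` factors through `d`, so dim W ≤ rank M ≤ rank d ≤ #X ≤ dim W. Equality throughout makes
  -- every weight space a line and `d` surjective.
  have hd : finrank ℂ W ≤ finrank ℂ (LinearMap.range d) := by
    refine hdim.trans ?_
    have e := Submodule.range_liftQ (LinearMap.ker d) M hker
    have hq := (LinearMap.quotKerEquivRange d).finrank_eq
    have : FiniteDimensional ℂ (V ⧸ LinearMap.ker d) :=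
      LinearEquiv.finiteDimensional (LinearMap.quotKerEquivRange d).symm
    rw [← e, ← hq]
    exact LinearMap.finrank_range_le _
  have hd2 : finrank ℂ (LinearMap.range d) ≤ Fintype.card X := by
    simpa using (LinearMap.range d).finrank_le
  have hXW : Fintype.card X = finrank ℂ W := le_antisymm hcard (hd.trans hd2)
  have hsurj : Function.Surjective d := by
    rw [← LinearMap.range_eq_top]
    refine Submodule.eq_top_of_finrank_eq ?_
    rw [Module.finrank_fintype_fun_eq_card]
    exact le_antisymm hd2 (hXW.trans_le hd)
  have hex : ∀ χ : X, ∃ y ∈ U χ.1, y ≠ 0 := fun χ => Submodule.exists_mem_ne_zero_of_ne_bot χ.2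
  choose y hyU hy0 using hex
  have hlin : LinearIndependent ℂ y :=
    (hU.comp Subtype.val_injective).linearIndependent _ hyU hy0
  let b := basisOfLinearIndependentOfCardEqFinrank' y hlin hXW
  have hb : ∀ χ, b χ = y χ := fun χ => by simp [b]
  have hF : ∀ F : End ℂ W, (∀ x, Commute F (M x)) → ∀ χ, ∃ c : ℂ, F (b χ) = c • b χ := by
    intro F hF χ
    refine hU.exists_smul_eq_of_basis b Subtype.val_injective (fun a => hb a ▸ hyU a) ?_
    rw [hb]
    refine (Submodule.mem_iInf _).2 fun x => ?_
    exact End.mapsTo_maxGenEigenspace_of_comm (hF x).symm _ ((Submodule.mem_iInf _).1 (hyU χ) x)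
  have hM : ∀ x χ, M x (b χ) = d x χ • b χ := by
    intro x χ
    obtain ⟨c, hc⟩ := hF (M x) (fun z => hcomm x z) χ
    have h1 : b χ ∈ (M x).maxGenEigenspace (d x χ) := by
      rw [hb]
      exact (Submodule.mem_iInf _).1 (hyU χ) x
    have h2 : b χ ∈ (M x).maxGenEigenspace c :=
      End.mem_maxGenEigenspace _ _ _ |>.2 ⟨1, by simp [hc]⟩
    by_cases hcd : d x χ = c
    · rw [hcd, hc]
    · exact absurd (Submodule.disjoint_def.1 (End.disjoint_genEigenspace (M x) hcd ⊤ ⊤) _ h1 h2)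
        (b.ne_zero χ)
  let e : X ≃ Fin (finrank ℂ W) := Fintype.equivFinOfCardEq hXW
  refine ⟨b.reindex e, (LinearMap.funLeft ℂ ℂ e.symm).comp d, ?_, ?_, ?_⟩
  · exact (LinearMap.funLeft_surjective_of_injective ℂ ℂ _ e.symm.injective).comp hsurj
  · intro x i
    simp [hM]
  · intro F h i
    simpa using hF F h (e.symm i)

/-- Generalized eigenvectors lift along surjections that intertwine two endomorphisms. -/
theorem exists_mem_maxGenEigenspace_of_surjective {E W : Type*} [AddCommGroup E] [Module ℂ E]
    [FiniteDimensional ℂ E] [AddCommGroup W] [Module ℂ W] {D : End ℂ E} {M : End ℂ W}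
    {π : E →ₗ[ℂ] W} (hπ : Function.Surjective π) (h : ∀ x, π (D x) = M (π x)) {μ : ℂ} {w : W}
    (hw : w ∈ M.maxGenEigenspace μ) : ∃ x ∈ D.maxGenEigenspace μ, π x = w := by
  open Polynomial in
  have hpoly : ∀ (q : ℂ[X]) x, π (aeval D q x) = aeval M q (π x) := by
    intro q x
    induction q using Polynomial.induction_on' with
    | add p q hp hq => simp [hp, hq]
    | monomial r c =>
      have hp : ∀ (r : ℕ) x, π ((D ^ r) x) = (M ^ r) (π x) := by
        intro r
        induction r with
        | zero => simp
        | succ r ih => intro x; rw [pow_succ', pow_succ', End.mul_apply, End.mul_apply, h, ih]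
      simp [aeval_monomial, hp]
  obtain ⟨s, hs⟩ := (End.mem_maxGenEigenspace _ _ _).1 hw
  have hne : D.charpoly ≠ 0 := D.charpoly_monic.ne_zero
  obtain ⟨q, hq, hqdvd⟩ := Polynomial.exists_eq_pow_rootMultiplicity_mul_and_not_dvd D.charpoly hne μ
  set r := D.charpoly.rootMultiplicity μ
  have hco : IsCoprime ((Polynomial.X - Polynomial.C μ) ^ s) q :=
    IsCoprime.pow_left ((Polynomial.irreducible_X_sub_C μ).coprime_iff_not_dvd.2 hqdvd)
  -- With charpoly(D) = (X - μ)^r q and a (X - μ)^s + b q = 1, the operator (b q)(D) maps into the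
  -- generalized μ-eigenspace by Cayley–Hamilton. Downstairs (b q)(M) fixes w, because (M - μ)^s
  -- kills w.
  obtain ⟨a, b, hab⟩ := hco
  obtain ⟨v, hv⟩ := hπ w
  refine ⟨Polynomial.aeval D (b * q) v, ?_, ?_⟩
  · refine (End.mem_maxGenEigenspace _ _ _).2 ⟨r, ?_⟩
    have e : (D - μ • 1) ^ r = Polynomial.aeval D ((Polynomial.X - Polynomial.C μ) ^ r) := by
      simp [Algebra.algebraMap_eq_smul_one]
    rw [e, ← End.mul_apply, ← map_mul,
      show (Polynomial.X - Polynomial.C μ) ^ r * (b * q) = b * D.charpoly by rw [hq]; ring, map_mul,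
      LinearMap.aeval_self_charpoly, mul_zero, LinearMap.zero_apply]
  · rw [hpoly, hv]
    have e : (M - μ • 1) ^ s = Polynomial.aeval M ((Polynomial.X - Polynomial.C μ) ^ s) := by
      simp [Algebra.algebraMap_eq_smul_one]
    have h1 := congrArg (fun p => Polynomial.aeval M p w) hab
    simp only [map_add, LinearMap.add_apply, map_one, End.one_apply] at h1
    rw [map_mul, End.mul_apply, ← e, hs, map_zero, zero_add] at h1
    exact h1

/-- The bracket of two generalized eigenvectors of a derivation is a generalized eigenvector for
the sum of the eigenvalues. -/
theorem derivation_mem_maxGenEigenspace {E : Type*} [AddCommGroup E] [Module ℂ E]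
    (br : E →ₗ[ℂ] E →ₗ[ℂ] E) {D : End ℂ E} (hD : ∀ x y, D (br x y) = br (D x) y + br x (D y))
    {μ ν : ℂ} {x y : E} (hx : x ∈ D.maxGenEigenspace μ) (hy : y ∈ D.maxGenEigenspace ν) :
    br x y ∈ D.maxGenEigenspace (μ + ν) := by
  have hclosed : ∀ (κ : ℂ) (z : E), (D - κ • 1) z ∈ D.maxGenEigenspace κ →
      z ∈ D.maxGenEigenspace κ := by
    intro κ z hz
    obtain ⟨r, hr⟩ := (End.mem_maxGenEigenspace _ _ _).1 hz
    exact (End.mem_maxGenEigenspace _ _ _).2 ⟨r + 1, by rw [pow_succ, End.mul_apply, hr]⟩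
  have key : ∀ (N r s : ℕ) (x y : E), r + s ≤ N → ((D - μ • 1) ^ r) x = 0 →
      ((D - ν • 1) ^ s) y = 0 → br x y ∈ D.maxGenEigenspace (μ + ν) := by
    intro N
    induction N with
    | zero =>
      intro r s x y hrs hx _
      obtain rfl : r = 0 := by omega
      simp at hx
      simp [hx]
    | succ N ih =>
      intro r s x y hrs hx hy
      rcases r with _ | r
      · simp at hx
        simp [hx]
      rcases s with _ | s
      · simp at hy
        simp [hy]
      refine hclosed _ _ ?_
      -- The Leibniz rule shifts by μ + ν into the shifts by μ and ν of the two factors. Each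
      -- summand lowers r + s by one.
      have e : (D - (μ + ν) • (1 : End ℂ E)) (br x y) =
          br ((D - μ • (1 : End ℂ E)) x) y + br x ((D - ν • (1 : End ℂ E)) y) := by
        simp [hD]; module
      rw [e]
      refine Submodule.add_mem _ (ih r (s + 1) _ _ (by omega) ?_ hy)
        (ih (r + 1) s _ _ (by omega) hx ?_)
      · rw [← End.mul_apply, ← pow_succ, hx]
      · rw [← End.mul_apply, ← pow_succ, hy]
  obtain ⟨r, hr⟩ := (End.mem_maxGenEigenspace _ _ _).1 hx
  obtain ⟨s, hs⟩ := (End.mem_maxGenEigenspace _ _ _).1 hy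
  exact key _ r s x y le_rfl hr hs

/-- The rank of the powers of an endomorphism on a subspace with a basis of chains. -/
theorem finrank_map_pow_of_chains {ι E : Type*} [Fintype ι] [AddCommGroup E] [Module ℂ E]
    (ℓ : ι → ℕ) (v : (Σ i, Fin (ℓ i)) → E) (hv : LinearIndependent ℂ v) (T : End ℂ E)
    (hT : ∀ i (r : Fin (ℓ i)), T (v ⟨i, r⟩) = if h : r.1 + 1 < ℓ i then v ⟨i, ⟨r + 1, h⟩⟩ else 0)
    (s : ℕ) : finrank ℂ ((Submodule.span ℂ (Set.range v)).map (T ^ s)) = ∑ i, (ℓ i - s) := by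
  have hpow : ∀ (s : ℕ) i (r : Fin (ℓ i)), (T ^ s) (v ⟨i, r⟩) =
      if h : r.1 + s < ℓ i then v ⟨i, ⟨r + s, h⟩⟩ else 0 := by
    intro s
    induction s with
    | zero => intro i r; simp
    | succ s ih =>
      intro i r
      rw [pow_succ', End.mul_apply, ih]
      split_ifs with h1 h2 h2
      · rw [hT, dif_pos (show (r.1 + s) + 1 < ℓ i from h2)]; rfl
      · rw [hT, dif_neg (show ¬ (r.1 + s) + 1 < ℓ i from h2)]
      · omega
      · simp
  -- The image of T^s is spanned by the chain members at positions at least s. Chain i has `ℓ i - s`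
  -- of them, with truncated subtraction for short chains.
  let g : (Σ i, Fin (ℓ i - s)) → Σ i, Fin (ℓ i) := fun a => ⟨a.1, ⟨a.2 + s, by omega⟩⟩
  have hg : Function.Injective g := by
    rintro ⟨i, r⟩ ⟨j, q⟩ h
    simp only [g, Sigma.mk.injEq] at h
    obtain ⟨rfl, h⟩ := h
    simp only [heq_eq_eq, Fin.mk.injEq, add_left_inj] at h
    rw [Fin.ext h]
  have hspan : (Submodule.span ℂ (Set.range v)).map (T ^ s) =
      Submodule.span ℂ (Set.range (v ∘ g)) := by
    rw [Submodule.map_span]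
    refine le_antisymm (Submodule.span_le.2 ?_) (Submodule.span_le.2 ?_)
    · rintro _ ⟨_, ⟨⟨i, r⟩, rfl⟩, rfl⟩
      rw [hpow]
      split_ifs with h
      · exact Submodule.subset_span ⟨⟨i, ⟨r, by omega⟩⟩, rfl⟩
      · exact zero_mem _
    · rintro _ ⟨⟨i, r⟩, rfl⟩
      refine Submodule.subset_span ⟨v ⟨i, ⟨r, by omega⟩⟩, ⟨_, rfl⟩, ?_⟩
      rw [hpow, dif_pos (show r.1 + s < ℓ i by omega)]
      rfl
  rw [hspan, finrank_span_eq_card (hv.comp g hg)]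
  simp

/-- Two functions on finite types whose fibres have the same sizes differ by a bijection. -/
theorem exists_equiv_of_card_fiber_eq {ι ι' κ : Type*} [Fintype ι] [Fintype ι'] [DecidableEq κ]
    {f : ι → κ} {g : ι' → κ} (h : ∀ s, (Finset.univ.filter fun i => f i = s).card =
      (Finset.univ.filter fun i => g i = s).card) : ∃ σ : ι ≃ ι', ∀ i, f i = g (σ i) := by
  have he : ∀ s, Nonempty ({i // f i = s} ≃ {i // g i = s}) := by
    intro s
    refine ⟨Fintype.equivOfCardEq ?_⟩
    simpa [Fintype.card_subtype] using h s
  let σ : ι ≃ ι' := (Equiv.sigmaFiberEquiv f).symm.trans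
    ((Equiv.sigmaCongrRight fun s => (he s).some).trans (Equiv.sigmaFiberEquiv g))
  exact ⟨σ, fun i => (((he (f i)).some ⟨i, rfl⟩).2).symm⟩

/-- A finite family of natural numbers is determined up to order by the sums of its truncations. -/
theorem exists_perm_of_sum_tsub_eq {ι : Type*} [Fintype ι] {f g : ι → ℕ}
    (h : ∀ s, ∑ i, (f i - s) = ∑ i, (g i - s)) : ∃ σ : Equiv.Perm ι, ∀ i, f i = g (σ i) := by
  classical
  -- Consecutive truncated sums differ by the number of members larger than s. These counts
  -- determine how often each value occurs.
  have hgt : ∀ (f : ι → ℕ) s, ∑ i, (f i - s) =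
      ∑ i, (f i - (s + 1)) + (Finset.univ.filter fun i => s < f i).card := by
    intro f s
    rw [Finset.card_filter, ← Finset.sum_add_distrib]
    refine Finset.sum_congr rfl fun i _ => ?_
    split_ifs <;> omega
  have h1 : ∀ s, (Finset.univ.filter fun i => s < f i).card =
      (Finset.univ.filter fun i => s < g i).card := by
    intro s
    have e1 := hgt f s
    have e2 := hgt g s
    have := h s
    have := h (s + 1)
    omega
  have hle : ∀ (f : ι → ℕ) s, (Finset.univ.filter fun i => s < f i).card +
      (Finset.univ.filter fun i => f i ≤ s).card = Fintype.card ι := by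
    intro f s
    rw [← Finset.card_univ,
      ← Finset.card_filter_add_card_filter_not (s := Finset.univ) (fun i => s < f i)]
    simp
  have heq : ∀ (f : ι → ℕ) s, (Finset.univ.filter fun i => f i ≤ s + 1).card =
      (Finset.univ.filter fun i => f i ≤ s).card +
        (Finset.univ.filter fun i => f i = s + 1).card := by
    intro f s
    simp only [Finset.card_filter, ← Finset.sum_add_distrib]
    refine Finset.sum_congr rfl fun i _ => ?_
    split_ifs <;> omega
  refine exists_equiv_of_card_fiber_eq fun s => ?_
  rcases s with _ | s
  · have e1 := hle f 0
    have e2 := hle g 0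
    have e3 := h1 0
    simp only [nonpos_iff_eq_zero] at e1 e2
    omega
  · have e1 := hle f s
    have e2 := hle g s
    have e3 := h1 s
    have e4 := hle f (s + 1)
    have e5 := hle g (s + 1)
    have e6 := h1 (s + 1)
    have e7 := heq f s
    have e8 := heq g s
    omega

/-! ### Monotonicity of nilpotency, and embeddings onto ideals -/

namespace LieSuperalgebra

variable {V : Type u} [AddCommGroup V] [Module ℂ V] {A : LieSuperalgebra V}

theorem lowerCentral_mono {S T : Submodule ℂ V} (h : S ≤ T) (r : ℕ) :
    A.lowerCentral S r ≤ A.lowerCentral T r := by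
  induction r with
  | zero => exact h
  | succ r ih => exact Submodule.map₂_le_map₂ ih h

theorem IsNilpotentOn.mono {S T : Submodule ℂ V} (hT : A.IsNilpotentOn T) (h : S ≤ T) :
    A.IsNilpotentOn S := by
  obtain ⟨r, hr⟩ := hT
  exact ⟨r, le_bot_iff.1 ((lowerCentral_mono h r).trans hr.le)⟩

/-- An injective homomorphism identifies its source with its range. -/
theorem isIsomorphic_ofIdeal_of_injective {E : Type v} [AddCommGroup E] [Module ℂ E]
    {B : LieSuperalgebra E} (φ : E →ₗ[ℂ] V) (hφ : Function.Injective φ)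
    (hbr : ∀ a b, φ (B.bracket a b) = A.bracket (φ a) (φ b))
    (hpart : ∀ i a, φ a ∈ A.part i ↔ a ∈ B.part i) {I : Submodule ℂ V} (hI : A.IsIdeal I)
    (hr : LinearMap.range φ = I) : IsIsomorphic (A.ofIdeal I hI) B := by
  subst hr
  let e := LinearEquiv.ofInjective φ hφ
  have he : ∀ a, (e a : V) = φ a := fun a => rfl
  refine ⟨e.symm, fun i x => ?_, fun x y => ?_⟩
  · rw [← hpart, ← he, e.apply_symm_apply]
    rfl
  · rw [LinearEquiv.symm_apply_eq]
    refine Subtype.ext ?_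
    rw [he, hbr, ← he, ← he, e.apply_symm_apply, e.apply_symm_apply]
    rfl

/-- A linear bijection that maps homogeneous vectors to homogeneous vectors reflects
homogeneity. -/
theorem mem_part_iff_of_bijective {E : Type v} [AddCommGroup E] [Module ℂ E]
    {B : LieSuperalgebra E} {φ : E →ₗ[ℂ] V} (hφ : Function.Injective φ)
    (h : ∀ i a, a ∈ B.part i → φ a ∈ A.part i) (i : ZMod 2) (a : E) :
    φ a ∈ A.part i ↔ a ∈ B.part i := by
  refine ⟨fun ha => ?_, h i a⟩
  have hdisj := Submodule.disjoint_def.1 A.isCompl.disjoint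
  obtain ⟨x, hx, y, hy, rfl⟩ := B.exists_add_eq a
  rw [map_add] at ha
  obtain rfl | rfl := zmod_two_cases i
  · have h1 : φ y = 0 := hdisj _ (by simpa using Submodule.sub_mem _ ha (h 0 x hx)) (h 1 y hy)
    rw [(map_eq_zero_iff φ hφ).1 h1, add_zero]
    exact hx
  · have h1 : φ x = 0 := hdisj _ (h 0 x hx) (by simpa using Submodule.sub_mem _ ha (h 1 y hy))
    rw [(map_eq_zero_iff φ hφ).1 h1, zero_add]
    exact hy

end LieSuperalgebra

/-! ### The model nilpotent superalgebra as a single nilpotent shift -/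

namespace ModelNilpotent

open LieSuperalgebra

section

variable {k p : ℕ}

def nIdxEquiv (n : Fin k → ℕ) (m : Fin p → ℕ) :
    NIdx n m ≃ Unit ⊕ (Σ j, Fin (n j)) ⊕ (Σ j, Fin (m j)) where
  toFun
    | .x1 => .inl ()
    | .x j i => .inr (.inl ⟨j, i⟩)
    | .y j i => .inr (.inr ⟨j, i⟩)
  invFun
    | .inl _ => .x1
    | .inr (.inl a) => .x a.1 a.2
    | .inr (.inr a) => .y a.1 a.2
  left_inv := by rintro (_ | _ | _) <;> rfl
  right_inv := by rintro (_ | _ | _) <;> rfl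

instance (n : Fin k → ℕ) (m : Fin p → ℕ) : Fintype (NIdx n m) :=
  Fintype.ofEquiv _ (nIdxEquiv n m).symm

def tIdxEquiv (k p : ℕ) : TIdx k p ≃ Option (Fin k) ⊕ Fin p where
  toFun
    | .t1 => .inl none
    | .t j => .inl (some j)
    | .t' j => .inr j
  invFun
    | .inl none => .t1
    | .inl (some j) => .t j
    | .inr j => .t' j
  left_inv := by rintro (_ | _ | _) <;> rfl
  right_inv := by rintro ((_ | _) | _) <;> rfl

instance : Fintype (TIdx k p) := Fintype.ofEquiv _ (tIdxEquiv k p).symm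

theorem sum_tIdx {M : Type*} [AddCommMonoid M] (f : TIdx k p → M) :
    ∑ s, f s = f .t1 + ∑ j, f (.t j) + ∑ j, f (.t' j) := by
  rw [← (tIdxEquiv k p).symm.sum_comp, Fintype.sum_sum_type, Fintype.sum_option]
  rfl

end

variable {k p : ℕ} (n : Fin k → ℕ) (m : Fin p → ℕ)

/-- The adjoint action of `x_1` on the model nilpotent superalgebra. -/
noncomputable def shiftMap : Module.End ℂ (NIdx n m →₀ ℂ) :=
  Finsupp.linearCombination ℂ (shift n m)

theorem shiftMap_single (a : NIdx n m) : shiftMap n m (Finsupp.single a 1) = shift n m a := by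
  simp [shiftMap]

theorem shift_apply_x1 (a : NIdx n m) : shift n m a .x1 = 0 := by
  rcases a with _ | _ | _ <;> simp only [shift] <;> (try split_ifs) <;> simp

theorem shiftMap_apply_x1 (f : NIdx n m →₀ ℂ) : shiftMap n m f .x1 = 0 := by
  simp [shiftMap, Finsupp.linearCombination_apply, Finsupp.sum, Finsupp.finsetSum_apply,
    shift_apply_x1]

/-- The span of all basis vectors except x_1 is an abelian ideal of codimension one, and x_1 acts on
it by the shift S. So the bracket is S applied to a_1 b - b_1 a, where a_1 is the x_1-coordinate. No
parity signs remain, because two odd vectors bracket to zero. -/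
theorem modelN_bracket (a b : NIdx n m →₀ ℂ) :
    (modelN n m).bracket a b = shiftMap n m (a .x1 • b - b .x1 • a) := by
  induction a using Finsupp.induction_linear with
  | zero => simp
  | add a a' h h' =>
    simp only [map_add, LinearMap.add_apply, h, h', map_sub, map_smul, Finsupp.add_apply, smul_add,
      add_smul]
    abel
  | single i r =>
    induction b using Finsupp.induction_linear with
    | zero => simp
    | add b b' h h' =>
      simp only [map_add, h, h', map_sub, map_smul, Finsupp.add_apply, smul_add, add_smul]
      abel
    | single j s =>
      have e : (modelN n m).bracket (Finsupp.single i r) (Finsupp.single j s) =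
          (r * s) • nTable n m i j := tableBracket_single _ _ _ _ _
      rw [e, ← Finsupp.smul_single_one i r, ← Finsupp.smul_single_one j s, map_sub]
      simp only [map_smul, shiftMap_single]
      rcases i with _ | ⟨i, i'⟩ | ⟨i, i'⟩ <;> rcases j with _ | ⟨j, j'⟩ | ⟨j, j'⟩ <;>
        simp [nTable, shift, mul_comm]

/-- The shift raises the position inside a block, and positions are bounded. -/
theorem shiftMap_pow_eq_zero : ∃ r, shiftMap n m ^ r = 0 := by
  let depth : NIdx n m → ℕ := fun a => match a with
    | .x1 => 0
    | .x _ i => i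
    | .y _ i => i
  let F : ℕ → Submodule ℂ (NIdx n m →₀ ℂ) := fun r => Finsupp.supported ℂ ℂ {a | r ≤ depth a}
  have hF : ∀ r, ∀ f ∈ F r, shiftMap n m f ∈ F (r + 1) := by
    intro r f hf
    refine supported_ind (P := fun f => shiftMap n m f ∈ F (r + 1)) (by simp)
      (fun _ _ h1 h2 => by simpa using Submodule.add_mem _ h1 h2)
      (fun c _ h => by simpa using Submodule.smul_mem _ c h) (fun a ha => ?_) f hf
    rw [shiftMap_single]
    rcases a with _ | ⟨j, i⟩ | ⟨j, i⟩ <;> simp only [shift]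
    · exact zero_mem _
    all_goals
      split_ifs
      · exact Finsupp.single_mem_supported _ _ (Nat.succ_le_succ ha)
      · exact zero_mem _
  have hpow : ∀ r f, (shiftMap n m ^ r) f ∈ F r := by
    intro r f
    induction r with
    | zero => exact (Finsupp.mem_supported _ _).2 fun _ _ => Nat.zero_le _
    | succ r ih =>
      rw [pow_succ', Module.End.mul_apply]
      exact hF r _ ih
  refine ⟨Finset.univ.sup depth + 1, LinearMap.ext fun f => ?_⟩
  have h := hpow (Finset.univ.sup depth + 1) f
  refine Finsupp.ext fun a => ?_
  by_contra ha
  have h1 : _ ≤ depth a := (Finsupp.mem_supported _ _).1 h (Finsupp.mem_support_iff.2 ha)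
  have h2 := Finset.le_sup (f := depth) (Finset.mem_univ a)
  omega

/-- For r ≥ 1 an element of the range of S^r has no x_1-coordinate, so bracketing it with b only
applies S and the scalar -b_1. This bounds the lower central series by the ranges of the powers of
S. -/
theorem modelN_bracket_mem_range (r : ℕ) {a : NIdx n m →₀ ℂ}
    (ha : a ∈ LinearMap.range (shiftMap n m ^ r)) (b : NIdx n m →₀ ℂ) :
    (modelN n m).bracket a b ∈ LinearMap.range (shiftMap n m ^ (r + 1)) := by
  rw [modelN_bracket]
  rcases r with _ | r
  · rw [zero_add, pow_one]
    exact ⟨_, rfl⟩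
  · obtain ⟨c, rfl⟩ := ha
    refine ⟨-b .x1 • c, ?_⟩
    have h0 : ((shiftMap n m ^ (r + 1)) c) .x1 = 0 := by
      rw [pow_succ', Module.End.mul_apply, shiftMap_apply_x1]
    rw [h0, zero_smul, zero_sub, pow_succ', Module.End.mul_apply]
    simp

/-- The image of the model nilpotent superalgebra under a homomorphism is nilpotent. -/
theorem isNilpotentOn_range {V : Type u} [AddCommGroup V] [Module ℂ V] {A : LieSuperalgebra V}
    (φ : (NIdx n m →₀ ℂ) →ₗ[ℂ] V)
    (hbr : ∀ a b, φ ((modelN n m).bracket a b) = A.bracket (φ a) (φ b)) :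
    A.IsNilpotentOn (LinearMap.range φ) := by
  obtain ⟨r, hr⟩ := shiftMap_pow_eq_zero n m
  have key : ∀ s, A.lowerCentral (LinearMap.range φ) s ≤
      (LinearMap.range (shiftMap n m ^ s)).map φ := by
    intro s
    induction s with
    | zero =>
      rintro _ ⟨a, rfl⟩
      exact ⟨a, ⟨a, by simp⟩, rfl⟩
    | succ s ih =>
      refine Submodule.map₂_le.2 fun x hx y hy => ?_
      obtain ⟨a, ha, rfl⟩ := ih hx
      obtain ⟨b, rfl⟩ := hy
      rw [← hbr]
      exact ⟨_, modelN_bracket_mem_range n m s ha b, rfl⟩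
  refine ⟨r, le_bot_iff.1 ((key r).trans ?_)⟩
  rw [hr]
  simp

/-! ### Generators and the abelianization -/

section Generators

variable {n m} (hn : ∀ j, 1 ≤ n j) (hm : ∀ j, 1 ≤ m j)

/-- The generators of the model nilpotent superalgebra: `x_1` and the first vector of each
block. -/
def gen : TIdx k p → NIdx n m
  | .t1 => .x1
  | .t j => .x j ⟨0, hn j⟩
  | .t' j => .y j ⟨0, hm j⟩

theorem gen_injective : Function.Injective (gen hn hm) := by
  rintro (_ | j | j) (_ | j' | j') h <;> simp_all [gen]

/-- The coordinates at the generators, that is, the projection to the abelianization. -/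
noncomputable def genCoord : (NIdx n m →₀ ℂ) →ₗ[ℂ] (TIdx k p → ℂ) :=
  LinearMap.pi fun s => Finsupp.lapply (gen hn hm s)

theorem genCoord_apply (f : NIdx n m →₀ ℂ) (s : TIdx k p) :
    genCoord hn hm f s = f (gen hn hm s) := rfl

theorem genCoord_single [DecidableEq (TIdx k p)] (s : TIdx k p) :
    genCoord hn hm (Finsupp.single (gen hn hm s) 1) = Pi.single s 1 := by
  classical
  ext s'
  rw [genCoord_apply, Finsupp.single_apply, Pi.single_apply]
  simp only [(gen_injective hn hm).eq_iff, eq_comm]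

/-- The linear section of the projection to the abelianization. -/
noncomputable def genLift : (TIdx k p → ℂ) →ₗ[ℂ] (NIdx n m →₀ ℂ) :=
  Fintype.linearCombination ℂ fun s => Finsupp.single (gen hn hm s) 1

theorem genCoord_genLift (w : TIdx k p → ℂ) : genCoord hn hm (genLift hn hm w) = w := by
  classical
  simp only [genLift, Fintype.linearCombination_apply, map_sum, map_smul, genCoord_single]
  ext s
  simp [Pi.single_apply]

theorem genCoord_surjective : Function.Surjective (genCoord hn hm) :=
  fun w => ⟨_, genCoord_genLift hn hm w⟩

theorem shift_apply_gen (a : NIdx n m) (s : TIdx k p) : shift n m a (gen hn hm s) = 0 := by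
  classical
  rcases a with _ | ⟨j, i⟩ | ⟨j, i⟩ <;> simp only [shift] <;> (try split_ifs) <;>
    rcases s with _ | j' | j' <;> simp [gen, Finsupp.single_apply]
  all_goals
    rintro rfl
    simp

theorem genCoord_shiftMap (f : NIdx n m →₀ ℂ) : genCoord hn hm (shiftMap n m f) = 0 := by
  ext s
  simp [genCoord_apply, shiftMap, Finsupp.linearCombination_apply, Finsupp.sum,
    Finsupp.finsetSum_apply, shift_apply_gen]

theorem genCoord_bracket (a b : NIdx n m →₀ ℂ) :
    genCoord hn hm ((modelN n m).bracket a b) = 0 := by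
  rw [modelN_bracket, genCoord_shiftMap]

/-- A basis vector that does not start a block is the shift of its predecessor. It follows that the
kernel of `genCoord` is contained in the range of the shift. -/
theorem single_mem_range_shiftMap {a : NIdx n m} (ha : ∀ s, gen hn hm s ≠ a) :
    Finsupp.single a 1 ∈ LinearMap.range (shiftMap n m) := by
  rcases a with _ | ⟨j, ⟨_ | i, hi⟩⟩ | ⟨j, ⟨_ | i, hi⟩⟩
  · exact absurd rfl (ha .t1)
  · exact absurd rfl (ha (.t j))
  · exact ⟨Finsupp.single (.x j ⟨i, by omega⟩) 1, by simp [shiftMap_single, shift, hi]⟩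
  · exact absurd rfl (ha (.t' j))
  · exact ⟨Finsupp.single (.y j ⟨i, by omega⟩) 1, by simp [shiftMap_single, shift, hi]⟩

theorem mem_range_shiftMap {f : NIdx n m →₀ ℂ} (hf : genCoord hn hm f = 0) :
    f ∈ LinearMap.range (shiftMap n m) := by
  rw [← Finsupp.sum_single f]
  refine Submodule.sum_mem _ fun a ha => ?_
  rw [← Finsupp.smul_single_one]
  refine Submodule.smul_mem _ _ (single_mem_range_shiftMap hn hm fun s hs => ?_)
  rw [Finsupp.mem_support_iff, ← hs] at ha
  exact ha (congrFun hf s)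

/-- A subspace closed under the bracket that generates modulo the square is everything. -/
theorem eq_top_of_genCoord {U : Submodule ℂ (NIdx n m →₀ ℂ)}
    (hU : ∀ a ∈ U, ∀ b ∈ U, (modelN n m).bracket a b ∈ U)
    (hgen : U.map (genCoord hn hm) = ⊤) : U = ⊤ := by
  set S := shiftMap n m
  have hlift : ∀ f, ∃ u ∈ U, ∃ d, f = u + S d := by
    intro f
    have : genCoord hn hm f ∈ U.map (genCoord hn hm) := by rw [hgen]; trivial
    obtain ⟨u, hu, huf⟩ := this
    obtain ⟨d, hd⟩ := mem_range_shiftMap hn hm (f := f - u) (by rw [map_sub, huf, sub_self])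
    exact ⟨u, hu, d, by rw [hd]; abel⟩
  obtain ⟨x, hxU, d0, hx⟩ := hlift (Finsupp.single .x1 1)
  have hSx : S x = -S (S d0) := by
    have h1 : S (Finsupp.single .x1 1) = 0 := by simp [S, shiftMap_single, shift]
    rw [hx, map_add] at h1
    exact eq_neg_of_add_eq_zero_left h1
  have hx1 : x .x1 = 1 := by
    have h := congrArg (fun f : NIdx n m →₀ ℂ => f .x1) hx
    simpa [S, shiftMap_apply_x1] using h.symm
  -- Nakayama-type step: the range of S^r lies in U plus the range of S^(r+1). The bracket with x,
  -- which is x_1 modulo the range of S, imitates S inside U.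
  have key : ∀ r a, ∃ u ∈ U, ∃ d, (S ^ r) a = u + (S ^ (r + 1)) d := by
    intro r
    induction r with
    | zero => intro a; simpa using hlift a
    | succ r ih =>
      intro a
      obtain ⟨u, hu, d, hd⟩ := ih a
      have hb : (modelN n m).bracket x u = S u - u .x1 • S x := by
        rw [modelN_bracket, hx1, one_smul, map_sub, map_smul]
      -- The error u_1 S x is harmless. For r = 0, S x already lies in the range of S²; for r ≥ 1, u
      -- lies in the range of S and u_1 = 0.
      have hur : ∃ d', u .x1 • S x = (S ^ (r + 2)) d' := by
        rcases r with _ | r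
        · exact ⟨-(u .x1 • d0), by rw [hSx]; simp [pow_succ]⟩
        · refine ⟨0, ?_⟩
          have h := congrArg (fun f : NIdx n m →₀ ℂ => f .x1) hd
          simp only [pow_succ' S, Module.End.mul_apply, Finsupp.add_apply] at h
          rw [shiftMap_apply_x1, shiftMap_apply_x1, add_zero] at h
          rw [← h, zero_smul, map_zero]
      obtain ⟨d', hd'⟩ := hur
      refine ⟨_, hU x hxU u hu, d' + d, ?_⟩
      rw [pow_succ', Module.End.mul_apply, hd, map_add, hb, map_add, ← hd', pow_succ' S (r + 1),
        Module.End.mul_apply]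
      abel
  obtain ⟨R, hR⟩ := shiftMap_pow_eq_zero n m
  have hle : ∀ s a, (S ^ (R - s)) a ∈ U := by
    intro s
    induction s with
    | zero => intro a; simp [S, hR]
    | succ s ih =>
      intro a
      -- Descending induction from S^R = 0. Once s ≥ R the truncated exponent stays at 0 and there
      -- is nothing to do.
      by_cases h : s < R
      · obtain ⟨u, hu, d, hd⟩ := key (R - (s + 1)) a
        rw [hd, show R - (s + 1) + 1 = R - s by omega]
        exact U.add_mem hu (ih d)
      · rw [show R - (s + 1) = R - s by omega]
        exact ih a
  rw [eq_top_iff]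
  intro a _
  simpa using hle R a

/-- The matrix of weights at the generators is triangular with ones on the diagonal: only t_1 acts
nontrivially on x_1, and each further torus vector singles out the head of its own block. -/
theorem weight_gen_eq_zero {c : TIdx k p → ℂ}
    (hc : ∀ s', ∑ s, c s * weight n m s (gen hn hm s') = 0) : c = 0 := by
  have h1 : c .t1 = 0 := by
    have h := hc .t1
    rw [sum_tIdx] at h
    simpa [weight, gen] using h
  ext s
  rcases s with _ | j | j
  · exact h1
  · have h := hc (.t j)
    rw [sum_tIdx] at h
    simpa [weight, gen, h1] using h
  · have h := hc (.t' j)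
    rw [sum_tIdx] at h
    simpa [weight, gen, h1] using h

end Generators

/-! ### The standard extension SN satisfies the hypotheses -/

section Extension

theorem modelN_part (i : ZMod 2) :
    (modelN n m).part i = Finsupp.supported ℂ ℂ {a | nParity n m a = i} := rfl

theorem modelSN_part (i : ZMod 2) :
    (modelSN n m).part i = Finsupp.supported ℂ ℂ {a | snParity n m a = i} := rfl

theorem modelSN_bracket_inl (a b : NIdx n m →₀ ℂ) :
    Finsupp.lmapDomain ℂ ℂ (Sum.inl : _ → NIdx n m ⊕ TIdx k p) ((modelN n m).bracket a b) =
      (modelSN n m).bracket (Finsupp.lmapDomain ℂ ℂ Sum.inl a)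
        (Finsupp.lmapDomain ℂ ℂ Sum.inl b) := by
  induction a using Finsupp.induction_linear with
  | zero => simp
  | add a a' h h' => simp only [map_add, LinearMap.add_apply, h, h']
  | single i r =>
    have h := snTable_inl n m i b
    rw [← Finsupp.smul_single_one i r]
    simp only [map_smul, LinearMap.smul_apply]
    congr 1
    rw [Finsupp.lmapDomain_apply _ _ _ (Finsupp.single i 1), Finsupp.mapDomain_single]
    exact h.symm

theorem mem_range_lmapDomain_inl {z : (NIdx n m ⊕ TIdx k p) →₀ ℂ} :
    z ∈ LinearMap.range (Finsupp.lmapDomain ℂ ℂ (Sum.inl : NIdx n m → NIdx n m ⊕ TIdx k p)) ↔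
      ∀ s, z (.inr s) = 0 := by
  constructor
  · rintro ⟨a, rfl⟩ s
    exact Finsupp.mapDomain_of_notMem_range _ _ (by simp)
  · intro h
    rw [← Finsupp.sum_single z]
    refine Submodule.sum_mem _ fun a ha => ?_
    rcases a with a | s
    · exact ⟨Finsupp.single a (z (.inl a)), by simp⟩
    · exact absurd (h s) (Finsupp.mem_support_iff.1 ha)

theorem modelSN_square_le : (modelSN n m).square ≤
    LinearMap.range (Finsupp.lmapDomain ℂ ℂ (Sum.inl : NIdx n m → NIdx n m ⊕ TIdx k p)) := by
  refine Submodule.map₂_le.2 fun x hx y hy => ?_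
  clear hx hy
  induction x using Finsupp.induction_linear with
  | zero => simp
  | add a a' h h' => simpa using Submodule.add_mem _ h h'
  | single i r =>
    induction y using Finsupp.induction_linear with
    | zero => simp
    | add a a' h h' => simpa using Submodule.add_mem _ h h'
    | single j s =>
      have e : (modelSN n m).bracket (Finsupp.single i r) (Finsupp.single j s) =
        (r * s) • snTable n m i j := tableBracket_single _ _ _ _ _
      rw [e]
      refine Submodule.smul_mem _ _ ?_
      rw [mem_range_lmapDomain_inl]
      intro t
      rcases i with i | i <;> rcases j with j | j
      · exact Finsupp.mapDomain_of_notMem_range _ _ (by simp)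
      all_goals simp [snTable]

/-- Modulo N² only the torus component of z acts on N, and it acts diagonally on the generators. -/
theorem modelSN_bracket_apply_gen {n m} (hn : ∀ j, 1 ≤ n j) (hm : ∀ j, 1 ≤ m j)
    (a : NIdx n m →₀ ℂ) (z : (NIdx n m ⊕ TIdx k p) →₀ ℂ) (s' : TIdx k p) :
    (modelSN n m).bracket (Finsupp.lmapDomain ℂ ℂ Sum.inl a) z (.inl (gen hn hm s')) =
      -(∑ s, z (.inr s) * weight n m s (gen hn hm s')) * a (gen hn hm s') := by
  classical
  induction z using Finsupp.induction_linear with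
  | zero => simp
  | add z z' h h' =>
    simp only [map_add, Finsupp.add_apply, h, h', add_mul, Finset.sum_add_distrib]
    ring
  | single i r =>
    rcases i with i | t
    · have e : Finsupp.single (Sum.inl i : NIdx n m ⊕ TIdx k p) r =
        Finsupp.lmapDomain ℂ ℂ Sum.inl (Finsupp.single i r) := by simp
      rw [e, ← modelSN_bracket_inl, Finsupp.lmapDomain_apply, Finsupp.mapDomain_apply Sum.inl_injective]
      have h := congrFun (genCoord_bracket hn hm a (Finsupp.single i r)) s'
      rw [genCoord_apply] at h
      rw [h, ← e]
      simp
    · induction a using Finsupp.induction_linear with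
      | zero => simp
      | add a a' h h' =>
        simp only [map_add, LinearMap.add_apply, Finsupp.add_apply, h, h']
        ring
      | single j q =>
        have e : (modelSN n m).bracket (Finsupp.single (Sum.inl j) q) (Finsupp.single (.inr t) r) =
          (q * r) • snTable n m (.inl j) (.inr t) := tableBracket_single _ _ _ _ _
        rw [Finsupp.lmapDomain_apply, Finsupp.mapDomain_single, e]
        simp only [snTable, Finsupp.smul_apply, Finsupp.neg_apply, Finsupp.single_apply,
          Sum.inl.injEq, Sum.inr.injEq, smul_eq_mul, ite_mul, zero_mul, Finset.sum_ite_eq,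
          Finset.mem_univ, if_true]
        split_ifs with h
        · rw [h]; ring
        · ring

-- N contains the square and is a nilpotent ideal. Nothing larger is nilpotent: a nonzero torus
-- component has a nonzero weight on some generator. This is what lets the maximality hypothesis
-- bound dim L from below.
variable {n m} in
theorem modelSN_isSolvableExtension (hn : ∀ j, 1 ≤ n j) (hm : ∀ j, 1 ≤ m j) :
    IsSolvableExtension n m (modelSN n m) := by
  set φ := Finsupp.lmapDomain ℂ ℂ (Sum.inl : NIdx n m → NIdx n m ⊕ TIdx k p) with hφdef
  have hφ : Function.Injective φ := Finsupp.mapDomain_injective Sum.inl_injective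
  have hsq : (modelSN n m).square ≤ LinearMap.range φ := modelSN_square_le n m
  have hnil : (modelSN n m).IsNilpotentOn (LinearMap.range φ) :=
    isNilpotentOn_range n m φ (modelSN_bracket_inl n m)
  have hpart : ∀ i a, a ∈ (modelN n m).part i → φ a ∈ (modelSN n m).part i := by
    intro i a ha
    refine supported_ind (P := fun a => φ a ∈ (modelSN n m).part i) (by simp)
      (fun _ _ h1 h2 => by simpa using Submodule.add_mem _ h1 h2)
      (fun c _ h => by simpa using Submodule.smul_mem _ c h) (fun a ha => ?_) a ha
    rw [hφdef, Finsupp.lmapDomain_apply, Finsupp.mapDomain_single, modelSN_part]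
    exact Finsupp.single_mem_supported _ _ ha
  have hideal : (modelSN n m).IsIdeal (LinearMap.range φ) := by
    refine ⟨?_, fun x y _ => hsq (bracket_mem_square _ x y),
      fun x y _ => hsq (bracket_mem_square _ x y)⟩
    rintro _ ⟨a, rfl⟩
    obtain ⟨x, hx, y, hy, rfl⟩ := (modelN n m).exists_add_eq a
    rw [map_add]
    exact Submodule.add_mem_sup ⟨⟨x, rfl⟩, hpart 0 x hx⟩ ⟨⟨y, rfl⟩, hpart 1 y hy⟩
  have hrad : (modelSN n m).nilradical = LinearMap.range φ := by
    refine le_antisymm (sSup_le ?_)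
      (le_sSup (a := LinearMap.range φ)
        (s := {I | (modelSN n m).IsIdeal I ∧ (modelSN n m).IsNilpotentOn I}) ⟨hideal, hnil⟩)
    rintro I ⟨hI, r, hr⟩ z hz
    rw [hφdef, mem_range_lmapDomain_inl]
    refine congrFun (weight_gen_eq_zero hn hm fun s' => ?_)
    by_contra hne
    set g := gen hn hm s'
    -- Repeated bracketing with z multiplies the coordinate at g by a nonzero scalar each time, so
    -- no term of the lower central series of I vanishes.
    have key : ∀ q, ∃ a : NIdx n m →₀ ℂ, φ a ∈ (modelSN n m).lowerCentral I q ∧ a g ≠ 0 := by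
      have step : ∀ a : NIdx n m →₀ ℂ, a g ≠ 0 → ∃ b, φ b = (modelSN n m).bracket (φ a) z ∧
          b g ≠ 0 := by
        intro a ha
        obtain ⟨b, hb⟩ := hsq (bracket_mem_square _ (φ a) z)
        refine ⟨b, hb, ?_⟩
        have h := modelSN_bracket_apply_gen hn hm a z s'
        rw [← hφdef, ← hb, hφdef, Finsupp.lmapDomain_apply,
          Finsupp.mapDomain_apply Sum.inl_injective] at h
        rw [h]
        exact mul_ne_zero (neg_ne_zero.2 hne) ha
      intro q
      induction q with
      | zero =>
        obtain ⟨b, hb, hb0⟩ := step (Finsupp.single g 1) (by simp)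
        exact ⟨b, by rw [hb]; exact hI.left _ _ hz, hb0⟩
      | succ q ih =>
        obtain ⟨a, ha, ha0⟩ := ih
        obtain ⟨b, hb, hb0⟩ := step a ha0
        exact ⟨b, by rw [hb]; exact Submodule.apply_mem_map₂ _ ha hz, hb0⟩
    obtain ⟨a, ha, ha0⟩ := key r
    rw [hr, Submodule.mem_bot, map_eq_zero_iff _ hφ] at ha
    exact ha0 (by rw [ha]; rfl)
  have hsqnil := hnil.mono hsq
  exact ⟨isSolvable_of_isNilpotentOn_square hsqnil, hsqnil,
    isIsomorphic_ofIdeal_of_injective φ hφ (modelSN_bracket_inl n m)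
      (mem_part_iff_of_bijective hφ hpart) _ hrad.symm⟩

end Extension

end ModelNilpotent

/-! ### Chains of generators and derivations with generic eigenvalues -/

namespace ModelNilpotent

open LieSuperalgebra Module

variable {k p : ℕ} {n : Fin k → ℕ} {m : Fin p → ℕ}

theorem modelN_bracket_swap (a b : NIdx n m →₀ ℂ) :
    (modelN n m).bracket a b = -(modelN n m).bracket b a := by
  rw [modelN_bracket, modelN_bracket, ← map_neg, neg_sub]

theorem modelN_bracket_self (a : NIdx n m →₀ ℂ) : (modelN n m).bracket a a = 0 := by
  rw [modelN_bracket, sub_self, map_zero]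

theorem modelN_bracket_apply_x1 (a b : NIdx n m →₀ ℂ) : (modelN n m).bracket a b .x1 = 0 := by
  rw [modelN_bracket, shiftMap_apply_x1]

/-- The bracket depends only on a_1 b - b_1 a, and x_1 (a_1 b - b_1 a) = a_1 (x_1 b - b_1 x) - b_1
(x_1 a - a_1 x). It expresses any bracket through brackets with x, so that eigenvalues can be
compared. -/
theorem smul_modelN_bracket (x a b : NIdx n m →₀ ℂ) :
    x .x1 • (modelN n m).bracket a b =
      a .x1 • (modelN n m).bracket x b - b .x1 • (modelN n m).bracket x a := by
  simp only [modelN_bracket, map_sub, map_smul]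
  module

/-- Each bracket with x moves one step down the ranges of the powers of the shift, so every chain
ends. -/
theorem modelN_bracket_pow_eq_zero (x : NIdx n m →₀ ℂ) :
    ∃ r, (modelN n m).bracket x ^ r = 0 := by
  obtain ⟨r, hr⟩ := shiftMap_pow_eq_zero n m
  have key : ∀ s a, ((modelN n m).bracket x ^ s) a ∈ LinearMap.range (shiftMap n m ^ s) := by
    intro s a
    induction s with
    | zero => exact ⟨a, by simp⟩
    | succ s ih =>
      rw [pow_succ' ((modelN n m).bracket x), End.mul_apply, modelN_bracket_swap]
      exact Submodule.neg_mem _ (modelN_bracket_mem_range n m s ih x)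
  refine ⟨r, LinearMap.ext fun a => ?_⟩
  simpa [hr] using key r a

/-- Parity of the generators. -/
def tParity : TIdx k p → ZMod 2
  | .t1 => 0
  | .t _ => 0
  | .t' _ => 1

theorem nParity_gen (hn : ∀ j, 1 ≤ n j) (hm : ∀ j, 1 ≤ m j) (s : TIdx k p) :
    nParity n m (gen hn hm s) = tParity s := by
  rcases s with _ | _ | _ <;> rfl

/-- The chains obtained from generators `u` by applying the adjoint action of `u t1`, with `n' j`
or `m' j` members in the block `j`. -/
noncomputable def chainFamily (n' : Fin k → ℕ) (m' : Fin p → ℕ) (u : TIdx k p → NIdx n m →₀ ℂ) :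
    NIdx n' m' → NIdx n m →₀ ℂ
  | .x1 => u .t1
  | .x j i => ((modelN n m).bracket (u .t1) ^ i.val) (u (.t j))
  | .y j i => ((modelN n m).bracket (u .t1) ^ i.val) (u (.t' j))

theorem chainFamily_gen {n' : Fin k → ℕ} {m' : Fin p → ℕ} (hn' : ∀ j, 1 ≤ n' j)
    (hm' : ∀ j, 1 ≤ m' j) (u : TIdx k p → NIdx n m →₀ ℂ) (s : TIdx k p) :
    chainFamily n' m' u (gen hn' hm' s) = u s := by
  rcases s with _ | _ | _ <;> simp [chainFamily, gen]

/-- The chain through each generator ends after the prescribed number of steps. -/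
structure HasLengths (n' : Fin k → ℕ) (m' : Fin p → ℕ) (u : TIdx k p → NIdx n m →₀ ℂ) : Prop where
  even : ∀ j, ((modelN n m).bracket (u .t1) ^ n' j) (u (.t j)) = 0
  odd : ∀ j, ((modelN n m).bracket (u .t1) ^ m' j) (u (.t' j)) = 0

section Chains

variable {n' : Fin k → ℕ} {m' : Fin p → ℕ} {u : TIdx k p → NIdx n m →₀ ℂ}

theorem HasLengths.bracket_x (h : HasLengths n' m' u) (j : Fin k) (i : Fin (n' j)) :
    (modelN n m).bracket (u .t1) (chainFamily n' m' u (.x j i)) =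
      if h : i.val + 1 < n' j then chainFamily n' m' u (.x j ⟨i.val + 1, h⟩) else 0 := by
  rw [chainFamily, ← End.mul_apply, ← pow_succ']
  split_ifs with hi
  · rfl
  · rw [show i.val + 1 = n' j by omega, h.even]

theorem HasLengths.bracket_y (h : HasLengths n' m' u) (j : Fin p) (i : Fin (m' j)) :
    (modelN n m).bracket (u .t1) (chainFamily n' m' u (.y j i)) =
      if h : i.val + 1 < m' j then chainFamily n' m' u (.y j ⟨i.val + 1, h⟩) else 0 := by
  rw [chainFamily, ← End.mul_apply, ← pow_succ']
  split_ifs with hi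
  · rfl
  · rw [show i.val + 1 = m' j by omega, h.odd]

theorem HasLengths.bracket_shift (h : HasLengths n' m' u) (b : NIdx n' m') :
    (modelN n m).bracket (u .t1) (chainFamily n' m' u b) =
      Finsupp.linearCombination ℂ (chainFamily n' m' u) (shift n' m' b) := by
  rcases b with _ | ⟨j, i⟩ | ⟨j, i⟩
  · simp [shift, chainFamily, modelN_bracket_self]
  · rw [h.bracket_x, shift]
    split_ifs <;> simp
  · rw [h.bracket_y, shift]
    split_ifs <;> simp

/-- If brackets of members of the chains vanish, then the chains multiply as in a model nilpotent
superalgebra. -/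
theorem HasLengths.bracket_chainFamily (h : HasLengths n' m' u)
    (h0 : ∀ s s' (i i' : ℕ), s ≠ .t1 → s' ≠ .t1 → (modelN n m).bracket
      (((modelN n m).bracket (u .t1) ^ i) (u s)) (((modelN n m).bracket (u .t1) ^ i') (u s')) = 0)
    (a b : NIdx n' m') :
    (modelN n m).bracket (chainFamily n' m' u a) (chainFamily n' m' u b) =
      Finsupp.linearCombination ℂ (chainFamily n' m' u) (nTable n' m' a b) := by
  rcases a with _ | ⟨j, i⟩ | ⟨j, i⟩
  · exact h.bracket_shift b
  all_goals
    rcases b with _ | ⟨j', i'⟩ | ⟨j', i'⟩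
    · rw [modelN_bracket_swap, nTable, map_neg, ← h.bracket_shift]
      rfl
    all_goals
      rw [nTable, map_zero]
      · exact h0 _ _ _ _ (by simp) (by simp)
      all_goals simp

theorem finrank_map_part_zero (hpar : ∀ a, chainFamily n' m' u a ∈
      (modelN n m).part (nParity n' m' a))
    (hspan : Submodule.span ℂ (Set.range (chainFamily n' m' u)) = ⊤)
    (hlin : LinearIndependent ℂ (chainFamily n' m' u)) (h : HasLengths n' m' u) (s : ℕ) :
    finrank ℂ (((modelN n m).part 0).map ((modelN n m).bracket (u .t1) ^ s)) =
      (1 - s) + ∑ j, (n' j - s) := by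
  -- `none` stands for the chain consisting of `u .t1` alone, which its own adjoint action kills. It
  -- contributes the summand `1 - s`.
  let ℓ : Option (Fin k) → ℕ := fun o => o.elim 1 n'
  let g : (Σ o, Fin (ℓ o)) → NIdx n' m' := fun a => match a with
    | ⟨none, _⟩ => .x1
    | ⟨some j, i⟩ => .x j i
  have hg : Function.Injective g := by
    rintro ⟨_ | j, i⟩ ⟨_ | j', i'⟩ hh
    · have : i = i' := Subsingleton.elim (α := Fin 1) _ _
      rw [this]
    · simp [g] at hh
    · simp [g] at hh
    · cases hh
      rfl
  have hr : Set.range g = {a | nParity n' m' a = 0} := by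
    ext a
    constructor
    · rintro ⟨⟨_ | j, i⟩, rfl⟩ <;> rfl
    · intro ha
      rcases a with _ | ⟨j, i⟩ | ⟨j, i⟩
      · exact ⟨⟨none, (0 : Fin 1)⟩, rfl⟩
      · exact ⟨⟨some j, i⟩, rfl⟩
      · exact absurd ha (by simp [nParity])
  have e := finrank_map_pow_of_chains ℓ (chainFamily n' m' u ∘ g) (hlin.comp g hg)
    ((modelN n m).bracket (u .t1)) (by
      rintro (_ | j) i
      · have hi : ¬ i.val + 1 < ℓ none := by
          have : i.val < 1 := i.2
          simp [ℓ]
        rw [dif_neg hi]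
        exact modelN_bracket_self _
      · exact h.bracket_x j i) s
  rw [Set.range_comp, hr, (modelN n m).span_even_eq_part hpar hspan] at e
  rw [e, Fintype.sum_option]
  rfl

theorem finrank_map_part_one (hpar : ∀ a, chainFamily n' m' u a ∈
      (modelN n m).part (nParity n' m' a))
    (hspan : Submodule.span ℂ (Set.range (chainFamily n' m' u)) = ⊤)
    (hlin : LinearIndependent ℂ (chainFamily n' m' u)) (h : HasLengths n' m' u) (s : ℕ) :
    finrank ℂ (((modelN n m).part 1).map ((modelN n m).bracket (u .t1) ^ s)) =
      ∑ j, (m' j - s) := by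
  let g : (Σ o, Fin (m' o)) → NIdx n' m' := fun a => .y a.1 a.2
  have hg : Function.Injective g := by
    rintro ⟨j, i⟩ ⟨j', i'⟩ hh
    simp only [g, NIdx.y.injEq] at hh
    obtain ⟨rfl, hh⟩ := hh
    rw [eq_of_heq hh]
  have hr : Set.range g = {a | nParity n' m' a = 1} := by
    ext a
    constructor
    · rintro ⟨⟨j, i⟩, rfl⟩
      rfl
    · intro ha
      rcases a with _ | ⟨j, i⟩ | ⟨j, i⟩
      · exact absurd ha (by simp [nParity])
      · exact absurd ha (by simp [nParity])
      · exact ⟨⟨j, i⟩, rfl⟩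
  have e := finrank_map_pow_of_chains m' (chainFamily n' m' u ∘ g) (hlin.comp g hg)
    ((modelN n m).bracket (u .t1)) (fun j i => h.bracket_y j i) s
  rwa [Set.range_comp, hr, (modelN n m).span_even_eq_part hpar hspan] at e

theorem bracket_pow_mem_part {x : NIdx n m →₀ ℂ} (hx : x ∈ (modelN n m).part 0) {i : ZMod 2}
    {y : NIdx n m →₀ ℂ} (hy : y ∈ (modelN n m).part i) (r : ℕ) :
    ((modelN n m).bracket x ^ r) y ∈ (modelN n m).part i := by
  induction r with
  | zero => exact hy
  | succ r ih =>
    rw [pow_succ', End.mul_apply]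
    simpa using (modelN n m).bracket_mem 0 i _ _ hx ih

theorem chainFamily_mem_part (hu : ∀ s, u s ∈ (modelN n m).part (tParity s)) (a : NIdx n' m') :
    chainFamily n' m' u a ∈ (modelN n m).part (nParity n' m' a) := by
  rcases a with _ | ⟨j, i⟩ | ⟨j, i⟩
  · exact hu .t1
  · exact bracket_pow_mem_part (hu .t1) (hu (.t j)) _
  · exact bracket_pow_mem_part (hu .t1) (hu (.t' j)) _

end Chains

/-- With `x` an even element outside the abelian ideal of codimension one, the standard generators
give chains with the standard lengths. -/
theorem standard_chains (hn : ∀ j, 1 ≤ n j) (hm : ∀ j, 1 ≤ m j) {x : NIdx n m →₀ ℂ}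
    (hx1 : x .x1 ≠ 0) : ∃ u : TIdx k p → NIdx n m →₀ ℂ, u .t1 = x ∧
      (∀ s, s ≠ .t1 → u s ∈ (modelN n m).part (tParity s)) ∧ HasLengths n m u ∧
      LinearIndependent ℂ (chainFamily n m u) ∧
      Submodule.span ℂ (Set.range (chainFamily n m u)) = ⊤ := by
  classical
  let u : TIdx k p → NIdx n m →₀ ℂ := fun s =>
    if s = .t1 then x else Finsupp.single (gen hn hm s) 1
  have hu1 : u .t1 = x := by simp [u]
  have hux : ∀ j, u (.t j) = Finsupp.single (.x j ⟨0, hn j⟩) 1 := fun j => by simp [u, gen]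
  have huy : ∀ j, u (.t' j) = Finsupp.single (.y j ⟨0, hm j⟩) 1 := fun j => by simp [u, gen]
  -- On vectors without x_1-coordinate ad x is a nonzero multiple of the shift, so the chains
  -- consist of nonzero multiples of the standard basis vectors.
  have hT : ∀ v : NIdx n m →₀ ℂ, v .x1 = 0 →
      (modelN n m).bracket x v = x .x1 • shiftMap n m v := by
    intro v hv
    rw [modelN_bracket, hv, zero_smul, sub_zero, map_smul]
  have hpx : ∀ r j, ((modelN n m).bracket x ^ r) (u (.t j)) =
      if h : r < n j then Finsupp.single (.x j ⟨r, h⟩) (x .x1 ^ r) else 0 := by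
    intro r j
    induction r with
    | zero => rw [dif_pos (show 0 < n j from hn j)]; simp [hux]
    | succ r ih =>
      rw [pow_succ', End.mul_apply, ih]
      by_cases h : r < n j
      · rw [dif_pos h, hT _ (by simp), ← Finsupp.smul_single_one, map_smul, shiftMap_single, shift]
        split_ifs <;> simp [pow_succ']
      · rw [dif_neg h, dif_neg (by omega), map_zero]
  have hpy : ∀ r j, ((modelN n m).bracket x ^ r) (u (.t' j)) =
      if h : r < m j then Finsupp.single (.y j ⟨r, h⟩) (x .x1 ^ r) else 0 := by
    intro r j
    induction r with
    | zero => rw [dif_pos (show 0 < m j from hm j)]; simp [huy]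
    | succ r ih =>
      rw [pow_succ', End.mul_apply, ih]
      by_cases h : r < m j
      · rw [dif_pos h, hT _ (by simp), ← Finsupp.smul_single_one, map_smul, shiftMap_single, shift]
        split_ifs <;> simp [pow_succ']
      · rw [dif_neg h, dif_neg (by omega), map_zero]
  have hspan : Submodule.span ℂ (Set.range (chainFamily n m u)) = ⊤ := by
    set U := Submodule.span ℂ (Set.range (chainFamily n m u)) with hU
    have hmem : ∀ a, a ≠ .x1 → Finsupp.single a (1 : ℂ) ∈ U := by
      rintro (_ | ⟨j, i⟩ | ⟨j, i⟩) ha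
      · exact absurd rfl ha
      · have h : chainFamily n m u (.x j i) ∈ U := Submodule.subset_span ⟨_, rfl⟩
        rw [chainFamily, hu1, hpx, dif_pos i.2, ← Finsupp.smul_single_one] at h
        exact (Submodule.smul_mem_iff _ (pow_ne_zero _ hx1)).1 h
      · have h : chainFamily n m u (.y j i) ∈ U := Submodule.subset_span ⟨_, rfl⟩
        rw [chainFamily, hu1, hpy, dif_pos i.2, ← Finsupp.smul_single_one] at h
        exact (Submodule.smul_mem_iff _ (pow_ne_zero _ hx1)).1 h
    have hx : Finsupp.single .x1 (1 : ℂ) ∈ U := by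
      have h : x ∈ U := by
        rw [← hu1]
        exact Submodule.subset_span ⟨.x1, rfl⟩
      rw [← Finsupp.single_add_erase .x1 x] at h
      have h2 : x.erase .x1 ∈ U := by
        rw [← Finsupp.sum_single (x.erase .x1)]
        refine Submodule.sum_mem _ fun a ha => ?_
        rw [← Finsupp.smul_single_one]
        refine Submodule.smul_mem _ _ (hmem a ?_)
        rintro rfl
        simp at ha
      have h3 := (Submodule.add_mem_iff_left _ h2).1 h
      rw [← Finsupp.smul_single_one] at h3
      exact (Submodule.smul_mem_iff _ hx1).1 h3
    rw [eq_top_iff]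
    intro f _
    rw [← Finsupp.sum_single f]
    refine Submodule.sum_mem _ fun a _ => ?_
    rw [← Finsupp.smul_single_one]
    refine Submodule.smul_mem _ _ ?_
    by_cases ha : a = .x1
    · rw [ha]; exact hx
    · exact hmem a ha
  refine ⟨u, hu1, ?_, ⟨?_, ?_⟩, ?_, hspan⟩
  · intro s hs
    rw [show u s = Finsupp.single (gen hn hm s) 1 by simp [u, hs]]
    exact Finsupp.single_mem_supported _ _ (nParity_gen hn hm s)
  · intro j
    rw [hu1, hpx, dif_neg (lt_irrefl _)]
  · intro j
    rw [hu1, hpy, dif_neg (lt_irrefl _)]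
  · exact linearIndependent_of_top_le_span_of_card_eq_finrank hspan.ge
      (Module.finrank_finsupp_self ℂ).symm

/-- The lengths of the chains are determined up to order. -/
theorem exists_perm_lengths (hn : ∀ j, 1 ≤ n j) (hm : ∀ j, 1 ≤ m j) {n' : Fin k → ℕ}
    {m' : Fin p → ℕ} {u : TIdx k p → NIdx n m →₀ ℂ}
    (hu : ∀ s, u s ∈ (modelN n m).part (tParity s)) (hx1 : u .t1 .x1 ≠ 0)
    (hspan : Submodule.span ℂ (Set.range (chainFamily n' m' u)) = ⊤)
    (hlin : LinearIndependent ℂ (chainFamily n' m' u)) (h : HasLengths n' m' u) :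
    (∃ σ : Equiv.Perm (Fin k), ∀ j, n j = n' (σ j)) ∧
      ∃ σ : Equiv.Perm (Fin p), ∀ j, m j = m' (σ j) := by
  obtain ⟨u0, hu1, hu0, hlen0, hlin0, hspan0⟩ := standard_chains hn hm hx1
  have hu0' : ∀ s, u0 s ∈ (modelN n m).part (tParity s) := by
    intro s
    by_cases hs : s = .t1
    · rw [hs, hu1]; exact hu .t1
    · exact hu0 s hs
  have e0 := finrank_map_part_zero (chainFamily_mem_part hu) hspan hlin h
  have e1 := finrank_map_part_one (chainFamily_mem_part hu) hspan hlin h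
  have f0 := finrank_map_part_zero (chainFamily_mem_part hu0') hspan0 hlin0 hlen0
  have f1 := finrank_map_part_one (chainFamily_mem_part hu0') hspan0 hlin0 hlen0
  -- Both systems of chains start from the same `u .t1`, so the two rank formulas compute the rank
  -- of the same operator on the same part.
  rw [hu1] at f0 f1
  refine ⟨exists_perm_of_sum_tsub_eq fun s => ?_, exists_perm_of_sum_tsub_eq fun s => ?_⟩
  · have e := e0 s
    rw [f0 s] at e
    omega
  · rw [← f1 s, e1 s]

/-- Generators that are generalized eigenvectors of a derivation for generic eigenvalues. -/
structure IsGenericSystem (hn : ∀ j, 1 ≤ n j) (hm : ∀ j, 1 ≤ m j) (D : End ℂ (NIdx n m →₀ ℂ))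
    (c : TIdx k p → ℕ) (u : TIdx k p → NIdx n m →₀ ℂ) : Prop where
  derivation : ∀ x y, D ((modelN n m).bracket x y) =
    (modelN n m).bracket (D x) y + (modelN n m).bracket x (D y)
  injective : Function.Injective c
  zero : c .t1 = 0
  mem_t1 : u .t1 ∈ D.maxGenEigenspace 1
  mem : ∀ s, s ≠ .t1 → u s ∈ D.maxGenEigenspace (c s * Complex.I)
  x1_ne_zero : u .t1 .x1 ≠ 0
  ne_zero : ∀ s, u s ≠ 0
  span : Submodule.span ℂ (Set.range fun s => genCoord hn hm (u s)) = ⊤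

namespace IsGenericSystem

variable {hn : ∀ j, 1 ≤ n j} {hm : ∀ j, 1 ≤ m j} {D : End ℂ (NIdx n m →₀ ℂ)}
  {c : TIdx k p → ℕ} {u : TIdx k p → NIdx n m →₀ ℂ}

/-- The value `c .t1 = 0` is not an eigenvalue (that of `u .t1` is 1). It reserves 0, so that
injectivity makes all other imaginary parts positive. -/
theorem pos (h : IsGenericSystem hn hm D c u) {s : TIdx k p} (hs : s ≠ .t1) : 0 < c s :=
  Nat.pos_of_ne_zero fun h0 => hs (h.injective (h0.trans h.zero.symm))

theorem pow_mem (h : IsGenericSystem hn hm D c u) {s : TIdx k p} (hs : s ≠ .t1) (i : ℕ) :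
    ((modelN n m).bracket (u .t1) ^ i) (u s) ∈ D.maxGenEigenspace (i + c s * Complex.I) := by
  induction i with
  | zero => simpa using h.mem s hs
  | succ i ih =>
    rw [pow_succ', End.mul_apply]
    have h1 := derivation_mem_maxGenEigenspace _ h.derivation h.mem_t1 ih
    rw [show ((i + 1 : ℕ) : ℂ) + c s * Complex.I = 1 + (i + c s * Complex.I) by push_cast; ring]
    exact h1

/-- A member beyond the head of its chain is a bracket and has no x_1-coordinate. So [a,b] is
proportional to [u_{t1}, b], while their eigenvalues have imaginary parts that differ by c_s > 0. -/
theorem bracket_eq_zero_of_pos (h : IsGenericSystem hn hm D c u) {s s' : TIdx k p} {i i' : ℕ}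
    (hs : s ≠ .t1) (hs' : s' ≠ .t1) (hi : 0 < i') : (modelN n m).bracket
      (((modelN n m).bracket (u .t1) ^ i) (u s)) (((modelN n m).bracket (u .t1) ^ i') (u s')) = 0 := by
  set a := ((modelN n m).bracket (u .t1) ^ i) (u s)
  set b := ((modelN n m).bracket (u .t1) ^ i') (u s') with hb
  have hb1 : b .x1 = 0 := by
    obtain ⟨q, rfl⟩ := Nat.exists_eq_succ_of_ne_zero hi.ne'
    rw [hb, pow_succ', End.mul_apply, modelN_bracket_apply_x1]
  have e := smul_modelN_bracket (u .t1) a b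
  rw [hb1, zero_smul, sub_zero] at e
  have h1 := derivation_mem_maxGenEigenspace _ h.derivation (h.pow_mem hs i) (h.pow_mem hs' i')
  have h2 := derivation_mem_maxGenEigenspace _ h.derivation h.mem_t1 (h.pow_mem hs' i')
  have hne : (i + c s * Complex.I) + (i' + c s' * Complex.I) ≠ 1 + (i' + c s' * Complex.I) := by
    intro hh
    have := congrArg Complex.im hh
    have hp := h.pos hs
    simp at this
    omega
  have h0 := Submodule.disjoint_def.1 (End.disjoint_genEigenspace D hne ⊤ ⊤) _
    (Submodule.smul_mem _ (u .t1 .x1) h1) (by rw [e]; exact Submodule.smul_mem _ _ h2)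
  exact (smul_eq_zero.1 h0).resolve_left h.x1_ne_zero

theorem bracket_eq_zero (h : IsGenericSystem hn hm D c u) (s s' : TIdx k p) (i i' : ℕ)
    (hs : s ≠ .t1) (hs' : s' ≠ .t1) : (modelN n m).bracket
      (((modelN n m).bracket (u .t1) ^ i) (u s)) (((modelN n m).bracket (u .t1) ^ i') (u s')) = 0 := by
  rcases Nat.eq_zero_or_pos i' with rfl | hi'
  swap
  · exact h.bracket_eq_zero_of_pos hs hs' hi'
  rcases Nat.eq_zero_or_pos i with rfl | hi
  swap
  · rw [modelN_bracket_swap, h.bracket_eq_zero_of_pos hs' hs hi, neg_zero]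
  by_cases hss : s = s'
  · rw [hss, modelN_bracket_self]
  have e := smul_modelN_bracket (u .t1) (u s) (u s')
  simp only [pow_zero, End.one_apply]
  have h1 := derivation_mem_maxGenEigenspace _ h.derivation (h.mem s hs) (h.mem s' hs')
  have h2 := derivation_mem_maxGenEigenspace _ h.derivation h.mem_t1 (h.mem s hs)
  have h3 := derivation_mem_maxGenEigenspace _ h.derivation h.mem_t1 (h.mem s' hs')
  -- Two chain heads: their bracket has a purely imaginary eigenvalue, whereas both brackets with `u
  -- .t1` have real part 1.
  have hne2 : 1 + c s * Complex.I ≠ c s * Complex.I + c s' * Complex.I := by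
    intro hh
    have := congrArg Complex.re hh
    simp at this
  have hne3 : 1 + c s' * Complex.I ≠ c s * Complex.I + c s' * Complex.I := by
    intro hh
    have := congrArg Complex.re hh
    simp at this
  have h0 := Submodule.disjoint_def.1
    (End.independent_maxGenEigenspace D (c s * Complex.I + c s' * Complex.I)) _
    (Submodule.smul_mem _ (u .t1 .x1) h1) (by
      rw [e]
      exact Submodule.sub_mem _
        (Submodule.smul_mem _ _ (Submodule.mem_iSup_of_mem _ (Submodule.mem_iSup_of_mem hne3 h3)))
        (Submodule.smul_mem _ _ (Submodule.mem_iSup_of_mem _ (Submodule.mem_iSup_of_mem hne2 h2))))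
  exact (smul_eq_zero.1 h0).resolve_left h.x1_ne_zero

/-- The eigenvalue of a member of the chains. -/
noncomputable def eigenvalue (c : TIdx k p → ℕ) (n' : Fin k → ℕ) (m' : Fin p → ℕ) :
    NIdx n' m' → ℂ
  | .x1 => 1
  | .x j i => i.val + c (.t j) * Complex.I
  | .y j i => i.val + c (.t' j) * Complex.I

/-- The imaginary part names the chain, being 0 only for `u .t1`; the real part is the position in
it. -/
theorem eigenvalue_injective (h : IsGenericSystem hn hm D c u) (n' : Fin k → ℕ) (m' : Fin p → ℕ) :
    Function.Injective (eigenvalue c n' m') := by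
  intro a b hab
  have hre := congrArg Complex.re hab
  have him := congrArg Complex.im hab
  rcases a with _ | ⟨j, i⟩ | ⟨j, i⟩ <;> rcases b with _ | ⟨j', i'⟩ | ⟨j', i'⟩ <;>
    simp [eigenvalue] at hre him
  · rfl
  · exact absurd him (by exact_mod_cast (h.pos (s := .t j') (by simp)).ne)
  · exact absurd him (by exact_mod_cast (h.pos (s := .t' j') (by simp)).ne)
  · exact absurd him (h.pos (by simp)).ne'
  · have := h.injective him
    simp only [TIdx.t.injEq] at this
    subst this
    rw [Fin.ext hre]
  · have := h.injective him
    simp at this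
  · exact absurd him (h.pos (by simp)).ne'
  · have := h.injective him
    simp at this
  · have := h.injective him
    simp only [TIdx.t'.injEq] at this
    subst this
    rw [Fin.ext hre]

theorem eigenvalue_ne_zero (h : IsGenericSystem hn hm D c u) (n' : Fin k → ℕ) (m' : Fin p → ℕ)
    (a : NIdx n' m') : eigenvalue c n' m' a ≠ 0 := by
  intro ha
  have him := congrArg Complex.im ha
  rcases a with _ | ⟨j, i⟩ | ⟨j, i⟩
  · simp [eigenvalue] at ha
  · simp [eigenvalue] at him
    exact absurd him (h.pos (by simp)).ne'
  · simp [eigenvalue] at him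
    exact absurd him (h.pos (by simp)).ne'

theorem chainFamily_mem (h : IsGenericSystem hn hm D c u) (n' : Fin k → ℕ) (m' : Fin p → ℕ)
    (a : NIdx n' m') : chainFamily n' m' u a ∈ D.maxGenEigenspace (eigenvalue c n' m' a) := by
  rcases a with _ | ⟨j, i⟩ | ⟨j, i⟩
  · exact h.mem_t1
  · exact h.pow_mem (by simp) _
  · exact h.pow_mem (by simp) _

/-- The chains multiply among themselves by a model table, so their span is a subalgebra. It
contains lifts of a spanning set of the abelianization. -/
theorem span_chainFamily (h : IsGenericSystem hn hm D c u) {n' : Fin k → ℕ} {m' : Fin p → ℕ}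
    (hn' : ∀ j, 1 ≤ n' j) (hm' : ∀ j, 1 ≤ m' j) (hlen : HasLengths n' m' u) :
    Submodule.span ℂ (Set.range (chainFamily n' m' u)) = ⊤ := by
  set U := Submodule.span ℂ (Set.range (chainFamily n' m' u)) with hU
  refine eq_top_of_genCoord hn hm ?_ ?_
  · have h2 : Submodule.map₂ (modelN n m).bracket U U ≤ U := by
      rw [hU, Submodule.map₂_span_span, Submodule.span_le]
      rintro _ ⟨_, ⟨a, rfl⟩, _, ⟨b, rfl⟩, rfl⟩
      rw [SetLike.mem_coe, ← Finsupp.range_linearCombination]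
      exact ⟨_, (hlen.bracket_chainFamily h.bracket_eq_zero a b).symm⟩
    exact fun a ha b hb => h2 (Submodule.apply_mem_map₂ _ ha hb)
  · rw [eq_top_iff, ← h.span, Submodule.span_le]
    rintro _ ⟨s, rfl⟩
    exact ⟨u s, Submodule.subset_span ⟨gen hn' hm' s, chainFamily_gen hn' hm' u s⟩, rfl⟩

/-- Take as length of a chain the first power of the adjoint action that kills its head. All members
are then nonzero, and their eigenvalues are distinct, so they are independent. -/
theorem exists_lengths (h : IsGenericSystem hn hm D c u) : ∃ (n' : Fin k → ℕ) (m' : Fin p → ℕ),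
    (∀ j, 1 ≤ n' j) ∧ (∀ j, 1 ≤ m' j) ∧ HasLengths n' m' u ∧
      LinearIndependent ℂ (chainFamily n' m' u) := by
  classical
  obtain ⟨r, hr⟩ := modelN_bracket_pow_eq_zero (u .t1)
  have hex : ∀ s, ∃ i, ((modelN n m).bracket (u .t1) ^ i) (u s) = 0 := fun s =>
    ⟨r, by rw [hr]; rfl⟩
  have hpos : ∀ s, 1 ≤ Nat.find (hex s) := by
    intro s
    rw [Nat.one_le_iff_ne_zero, Ne, Nat.find_eq_zero]
    simpa using h.ne_zero s
  refine ⟨fun j => Nat.find (hex (.t j)), fun j => Nat.find (hex (.t' j)), fun j => hpos _,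
    fun j => hpos _, ⟨fun j => Nat.find_spec (hex (.t j)), fun j => Nat.find_spec (hex (.t' j))⟩, ?_⟩
  refine ((End.independent_maxGenEigenspace D).comp
    (h.eigenvalue_injective _ _)).linearIndependent _ (h.chainFamily_mem _ _) ?_
  rintro (_ | ⟨j, i⟩ | ⟨j, i⟩)
  · exact h.ne_zero _
  · exact Nat.find_min (hex (.t j)) i.2
  · exact Nat.find_min (hex (.t' j)) i.2

end IsGenericSystem

theorem HasLengths.comp_perm {n' : Fin k → ℕ} {m' : Fin p → ℕ} {u : TIdx k p → NIdx n m →₀ ℂ}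
    (h : HasLengths n' m' u) {σ : Equiv.Perm (TIdx k p)} {σ0 : Equiv.Perm (Fin k)}
    {σ1 : Equiv.Perm (Fin p)} (h1 : σ .t1 = .t1) (hσ0 : ∀ j, σ (.t j) = .t (σ0 j))
    (hσ1 : ∀ j, σ (.t' j) = .t' (σ1 j)) (hn' : ∀ j, n j = n' (σ0 j))
    (hm' : ∀ j, m j = m' (σ1 j)) : HasLengths n m (u ∘ σ) := by
  refine ⟨fun j => ?_, fun j => ?_⟩
  · simp only [Function.comp_apply, h1, hσ0, hn']
    exact h.even _
  · simp only [Function.comp_apply, h1, hσ1, hm']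
    exact h.odd _

/-- A homogeneous generic system can be reordered so that its chains form a basis in which the
bracket is that of the model. -/
theorem IsGenericSystem.exists_perm {hn : ∀ j, 1 ≤ n j} {hm : ∀ j, 1 ≤ m j}
    {D : End ℂ (NIdx n m →₀ ℂ)} {c : TIdx k p → ℕ} {u : TIdx k p → NIdx n m →₀ ℂ}
    (h : IsGenericSystem hn hm D c u) (hu : ∀ s, u s ∈ (modelN n m).part (tParity s)) :
    ∃ σ : Equiv.Perm (TIdx k p), σ .t1 = .t1 ∧ (∀ s, tParity (σ s) = tParity s) ∧
      HasLengths n m (u ∘ σ) := by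
  obtain ⟨n', m', hn', hm', hlen, hlin⟩ := h.exists_lengths
  obtain ⟨⟨σ0, hσ0⟩, σ1, hσ1⟩ :=
    exists_perm_lengths hn hm hu h.x1_ne_zero (h.span_chainFamily hn' hm' hlen) hlin hlen
  let e := tIdxEquiv k p
  let σ : Equiv.Perm (TIdx k p) :=
    e.trans (((Equiv.optionCongr σ0).sumCongr σ1).trans e.symm)
  have h1 : σ .t1 = .t1 := rfl
  have h2 : ∀ j, σ (.t j) = .t (σ0 j) := fun j => rfl
  have h3 : ∀ j, σ (.t' j) = .t' (σ1 j) := fun j => rfl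
  refine ⟨σ, h1, ?_, hlen.comp_perm h1 h2 h3 hσ0 hσ1⟩
  rintro (_ | j | j)
  · rw [h1]
  · rw [h2]; rfl
  · rw [h3]; rfl

theorem IsGenericSystem.comp_perm {hn : ∀ j, 1 ≤ n j} {hm : ∀ j, 1 ≤ m j}
    {D : End ℂ (NIdx n m →₀ ℂ)} {c : TIdx k p → ℕ} {u : TIdx k p → NIdx n m →₀ ℂ}
    (h : IsGenericSystem hn hm D c u) {σ : Equiv.Perm (TIdx k p)} (h1 : σ .t1 = .t1) :
    IsGenericSystem hn hm D (c ∘ σ) (u ∘ σ) where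
  derivation := h.derivation
  injective := h.injective.comp σ.injective
  zero := by rw [Function.comp_apply, h1, h.zero]
  mem_t1 := by rw [Function.comp_apply, h1]; exact h.mem_t1
  mem s hs := h.mem (σ s) fun hh => hs (σ.injective (hh.trans h1.symm))
  x1_ne_zero := by rw [Function.comp_apply, h1]; exact h.x1_ne_zero
  ne_zero s := h.ne_zero _
  span := by
    rw [← h.span]
    congr 1
    exact σ.surjective.range_comp fun s => genCoord hn hm (u s)

/-- The basis of the model nilpotent superalgebra formed by the chains of a generic system. -/
noncomputable def IsGenericSystem.basis {hn : ∀ j, 1 ≤ n j} {hm : ∀ j, 1 ≤ m j}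
    {D : End ℂ (NIdx n m →₀ ℂ)} {c : TIdx k p → ℕ} {u : TIdx k p → NIdx n m →₀ ℂ}
    (h : IsGenericSystem hn hm D c u) (hlen : HasLengths n m u) :
    Basis (NIdx n m) ℂ (NIdx n m →₀ ℂ) :=
  basisOfTopLeSpanOfCardEqFinrank (chainFamily n m u) (h.span_chainFamily hn hm hlen).ge
    (Module.finrank_finsupp_self ℂ).symm

theorem IsGenericSystem.basis_apply {hn : ∀ j, 1 ≤ n j} {hm : ∀ j, 1 ≤ m j}
    {D : End ℂ (NIdx n m →₀ ℂ)} {c : TIdx k p → ℕ} {u : TIdx k p → NIdx n m →₀ ℂ}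
    (h : IsGenericSystem hn hm D c u) (hlen : HasLengths n m u) (a : NIdx n m) :
    h.basis hlen a = chainFamily n m u a := by
  simp [IsGenericSystem.basis]

/-- The chains span and have nonzero eigenvalues, so the generalized 0-eigenspace of D is trivial.
Invertibility of D is what allows torus elements to be corrected. -/
theorem IsGenericSystem.eq_zero_of_apply_eq_zero {hn : ∀ j, 1 ≤ n j} {hm : ∀ j, 1 ≤ m j}
    {D : End ℂ (NIdx n m →₀ ℂ)} {c : TIdx k p → ℕ} {u : TIdx k p → NIdx n m →₀ ℂ}
    (h : IsGenericSystem hn hm D c u) (hlen : HasLengths n m u) {v : NIdx n m →₀ ℂ}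
    (hv : D v = 0) : v = 0 :=
  (End.independent_maxGenEigenspace D).eq_zero_of_basis (h.chainFamily_mem n m)
    (h.span_chainFamily hn hm hlen) (h.eigenvalue_ne_zero n m)
    ((End.mem_maxGenEigenspace _ _ _).2 ⟨1, by simpa using hv⟩)

/-- An endomorphism that commutes with the derivation of a generic system is diagonal on the
generators. -/
theorem IsGenericSystem.exists_smul_eq {hn : ∀ j, 1 ≤ n j} {hm : ∀ j, 1 ≤ m j}
    {D : End ℂ (NIdx n m →₀ ℂ)} {c : TIdx k p → ℕ} {u : TIdx k p → NIdx n m →₀ ℂ}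
    (h : IsGenericSystem hn hm D c u) (hlen : HasLengths n m u) {K : End ℂ (NIdx n m →₀ ℂ)}
    (hK : Commute D K) (s : TIdx k p) : ∃ r : ℂ, K (u s) = r • u s := by
  have hmem : ∀ a, h.basis hlen a ∈ D.maxGenEigenspace (eigenvalue c n m a) := fun a => by
    rw [h.basis_apply]
    exact h.chainFamily_mem n m a
  obtain ⟨r, hr⟩ := (End.independent_maxGenEigenspace D).exists_smul_eq_of_basis (h.basis hlen)
    (h.eigenvalue_injective n m) hmem (a := gen hn hm s)
    (End.mapsTo_maxGenEigenspace_of_comm hK _ (hmem (gen hn hm s)))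
  rw [h.basis_apply, chainFamily_gen] at hr
  exact ⟨r, hr⟩

/-- A derivation with eigenvalue λ on `u .t1` raises the eigenvalue by λ at each step of a chain, as
the standard weights do. So it suffices to know the eigenvalues on the generators. -/
theorem chainFamily_eigen {hn : ∀ j, 1 ≤ n j} {hm : ∀ j, 1 ≤ m j} {K : End ℂ (NIdx n m →₀ ℂ)}
    (hK : ∀ x y, K ((modelN n m).bracket x y) =
      (modelN n m).bracket (K x) y + (modelN n m).bracket x (K y))
    {u : TIdx k p → NIdx n m →₀ ℂ} (t : TIdx k p)
    (hu : ∀ s, K (u s) = weight n m t (gen hn hm s) • u s) (a : NIdx n m) :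
    K (chainFamily n m u a) = weight n m t a • chainFamily n m u a := by
  have hpow : ∀ s (i : ℕ), K (((modelN n m).bracket (u .t1) ^ i) (u s)) =
      (weight n m t (gen hn hm s) + i * weight n m t .x1) •
        ((modelN n m).bracket (u .t1) ^ i) (u s) := by
    intro s i
    induction i with
    | zero => simpa using hu s
    | succ i ih =>
      have h1 := hu .t1
      rw [pow_succ', End.mul_apply, hK, ih, h1]
      simp only [map_smul, LinearMap.smul_apply, ← add_smul, gen]
      congr 1
      push_cast
      ring
  rcases a with _ | ⟨j, i⟩ | ⟨j, i⟩
  · exact hu .t1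
  · rw [chainFamily, hpow]
    congr 1
    rcases t with _ | t | t <;> simp [weight, gen]
    ring
  · rw [chainFamily, hpow]
    congr 1
    rcases t with _ | t | t <;> simp [weight, gen]
    ring

end ModelNilpotent

/-! ### Parity on the nilradical and on its abelianization -/

namespace ModelNilpotent

open LieSuperalgebra Module

section Sign

variable {k p : ℕ} {n : Fin k → ℕ} {m : Fin p → ℕ}

/-- The parity involution of the model nilpotent superalgebra. -/
noncomputable def signMap (n : Fin k → ℕ) (m : Fin p → ℕ) : End ℂ (NIdx n m →₀ ℂ) :=
  Finsupp.linearCombination ℂ fun a => Finsupp.single a ((-1 : ℂ) ^ (nParity n m a).val)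

theorem signMap_apply (f : NIdx n m →₀ ℂ) (a : NIdx n m) :
    signMap n m f a = (-1 : ℂ) ^ (nParity n m a).val * f a := by
  classical
  induction f using Finsupp.induction_linear with
  | zero => simp
  | add f g hf hg => simp [hf, hg, mul_add]
  | single b r =>
    simp only [signMap, Finsupp.linearCombination_single, Finsupp.smul_single, smul_eq_mul,
      Finsupp.single_apply]
    split_ifs with h
    · rw [h, mul_comm]
    · simp

theorem signMap_of_mem {i : ZMod 2} {f : NIdx n m →₀ ℂ} (hf : f ∈ (modelN n m).part i) :
    signMap n m f = (-1 : ℂ) ^ i.val • f := by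
  ext a
  rw [signMap_apply, Finsupp.smul_apply, smul_eq_mul]
  by_cases ha : f a = 0
  · simp [ha]
  · have h : nParity n m a = i :=
      (Finsupp.mem_supported _ _).1 hf (Finsupp.mem_support_iff.2 ha)
    rw [h]

theorem mem_part_of_signMap {i : ZMod 2} {f : NIdx n m →₀ ℂ}
    (hf : signMap n m f = (-1 : ℂ) ^ i.val • f) : f ∈ (modelN n m).part i := by
  rw [modelN_part, Finsupp.mem_supported]
  intro a ha
  have h := congrArg (fun f : NIdx n m →₀ ℂ => f a) hf
  simp only [signMap_apply, Finsupp.smul_apply, smul_eq_mul] at h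
  have h2 := mul_right_cancel₀ (Finsupp.mem_support_iff.1 ha) h
  show nParity n m a = i
  generalize nParity n m a = q at h2
  obtain rfl | rfl := zmod_two_cases q <;> obtain rfl | rfl := zmod_two_cases i <;>
    first | rfl | (exfalso; norm_num [ZMod.val_one] at h2)

theorem signMap_signMap (f : NIdx n m →₀ ℂ) : signMap n m (signMap n m f) = f := by
  ext a
  rw [signMap_apply, signMap_apply, ← mul_assoc, ← mul_pow]
  simp

theorem commute_signMap {K : End ℂ (NIdx n m →₀ ℂ)}
    (hK : ∀ i, ∀ f ∈ (modelN n m).part i, K f ∈ (modelN n m).part i) :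
    Commute (signMap n m) K := by
  refine LinearMap.ext fun f => ?_
  refine (modelN n m).homogeneous_induction
    (P := fun f => (signMap n m * K) f = (K * signMap n m) f)
    (fun x y h1 h2 => by rw [map_add, map_add, h1, h2]) (fun i f hf => ?_) f
  rw [End.mul_apply, End.mul_apply, signMap_of_mem hf, signMap_of_mem (hK i f hf), map_smul]

/-- The parity involution of the abelianization. -/
noncomputable def genSign (k p : ℕ) : End ℂ (TIdx k p → ℂ) :=
  LinearMap.pi fun s => (-1 : ℂ) ^ (tParity s).val • LinearMap.proj s

theorem genSign_apply (w : TIdx k p → ℂ) (s : TIdx k p) :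
    genSign k p w s = (-1 : ℂ) ^ (tParity s).val * w s := rfl

theorem genSign_genSign (w : TIdx k p → ℂ) : genSign k p (genSign k p w) = w := by
  ext s
  rw [genSign_apply, genSign_apply, ← mul_assoc, ← mul_pow]
  simp

theorem genCoord_signMap (hn : ∀ j, 1 ≤ n j) (hm : ∀ j, 1 ≤ m j) (f : NIdx n m →₀ ℂ) :
    genCoord hn hm (signMap n m f) = genSign k p (genCoord hn hm f) := by
  ext s
  rw [genCoord_apply, signMap_apply, genSign_apply, nParity_gen, genCoord_apply]

theorem sum_sign_eq_card_sub_card {κ : Type*} [Fintype κ] (f : κ → ZMod 2) :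
    ∑ i, (-1 : ℂ) ^ (f i).val = ((Finset.univ.filter fun i => f i = 0).card : ℂ) -
      (Finset.univ.filter fun i => f i = 1).card := by
  simp only [Finset.card_filter, Nat.cast_sum, ← Finset.sum_sub_distrib]
  refine Finset.sum_congr rfl fun i _ => ?_
  generalize f i = q
  obtain rfl | rfl := zmod_two_cases q <;> simp [ZMod.val_one]

theorem card_even_add_card_odd {κ : Type*} [Fintype κ] (f : κ → ZMod 2) :
    (Finset.univ.filter fun i => f i = 0).card + (Finset.univ.filter fun i => f i = 1).card =
      Fintype.card κ := by
  simp only [Finset.card_filter, ← Finset.sum_add_distrib]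
  rw [Finset.sum_congr rfl (g := fun _ => 1), Finset.sum_const, Finset.card_univ, smul_eq_mul,
    mul_one]
  intro i _
  generalize f i = q
  obtain rfl | rfl := zmod_two_cases q <;> simp

/-- A basis of homogeneous vectors of the abelianization can be numbered by the generators
compatibly with parity, such that the first vector has a nonzero first coordinate. -/
theorem exists_parity_equiv {ι : Type*} [Fintype ι] (w : Basis ι ℂ (TIdx k p → ℂ))
    (hw : ∀ i, ∃ c : ℂ, genSign k p (w i) = c • w i) :
    ∃ e : TIdx k p ≃ ι, w (e .t1) .t1 ≠ 0 ∧
      ∀ s, genSign k p (w (e s)) = (-1 : ℂ) ^ (tParity s).val • w (e s) := by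
  classical
  have hε : ∀ i, ∃ q : ZMod 2, genSign k p (w i) = (-1 : ℂ) ^ q.val • w i := by
    intro i
    obtain ⟨c, hc⟩ := hw i
    have h := genSign_genSign (w i)
    rw [hc, map_smul, hc, smul_smul] at h
    have h2 : (c * c - 1) • w i = 0 := by rw [sub_smul, h, one_smul, sub_self]
    have h3 : c * c = 1 := sub_eq_zero.1 ((smul_eq_zero.1 h2).resolve_right (w.ne_zero i))
    rcases mul_self_eq_one_iff.1 h3 with rfl | rfl
    · exact ⟨0, by simp [hc]⟩
    · exact ⟨1, by simp [hc, ZMod.val_one]⟩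
  choose ε hε using hε
  -- The trace of the parity involution is the number of even minus the number of odd vectors in any
  -- homogeneous basis. Together with the dimension it fixes both numbers, so a parity-preserving
  -- numbering exists.
  have tr : ∀ {κ : Type _} [Fintype κ] [DecidableEq κ] (b : Basis κ ℂ (TIdx k p → ℂ))
      (f : κ → ℂ), (∀ i, genSign k p (b i) = f i • b i) →
      LinearMap.trace ℂ _ (genSign k p) = ∑ i, f i := by
    intro κ _ _ b f hb
    rw [LinearMap.trace_eq_matrix_trace ℂ b, Matrix.trace]
    refine Finset.sum_congr rfl fun i _ => ?_
    simp [LinearMap.toMatrix_apply, hb]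
  have tr1 := tr w _ hε
  have tr2 : LinearMap.trace ℂ _ (genSign k p) =
      ∑ s : TIdx k p, (-1 : ℂ) ^ (tParity s).val := by
    rw [LinearMap.trace_eq_matrix_trace ℂ (Pi.basisFun ℂ _), Matrix.trace]
    refine Finset.sum_congr rfl fun i _ => ?_
    simp [genSign_apply]
  have hcard : Fintype.card ι = Fintype.card (TIdx k p) := by
    rw [← Module.finrank_eq_card_basis w, Module.finrank_fintype_fun_eq_card]
  have a1 := sum_sign_eq_card_sub_card ε
  have a2 := card_even_add_card_odd ε
  have b2 := card_even_add_card_odd (tParity : TIdx k p → ZMod 2)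
  rw [← tr1, tr2, sum_sign_eq_card_sub_card, sub_eq_sub_iff_add_eq_add] at a1
  norm_cast at a1
  obtain ⟨e, he⟩ := exists_equiv_of_card_fiber_eq (f := (tParity : TIdx k p → ZMod 2)) (g := ε)
    (by
      intro q
      obtain rfl | rfl := zmod_two_cases q <;> omega)
  obtain ⟨i0, hi0⟩ : ∃ i, w i .t1 ≠ 0 := by
    by_contra hcon
    push Not at hcon
    have h : (LinearMap.proj .t1 : (TIdx k p → ℂ) →ₗ[ℂ] ℂ) = 0 := w.ext fun i => hcon i
    have := LinearMap.congr_fun h (fun _ => 1)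
    simp at this
  -- The involution fixes the t1-coordinate, so a homogeneous vector in which it is nonzero is even
  -- and may be swapped into the place of `.t1`.
  have hε0 : ε i0 = 0 := by
    have h := congrFun (hε i0) .t1
    rw [genSign_apply, Pi.smul_apply, smul_eq_mul] at h
    have h2 := mul_right_cancel₀ hi0 h
    generalize ε i0 = q at h2
    obtain rfl | rfl := zmod_two_cases q
    · rfl
    · norm_num [ZMod.val_one, tParity] at h2
  refine ⟨e.trans (Equiv.swap (e .t1) i0), by simpa using hi0, fun s => ?_⟩
  have hs : ε (Equiv.swap (e .t1) i0 (e s)) = tParity s := by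
    rw [he s]
    have h1 : ε (e .t1) = 0 := (he .t1).symm
    rw [Equiv.swap_apply_def]
    split_ifs with h2 h3
    · rw [h2, h1, hε0]
    · rw [h3, h1, hε0]
    · rfl
  rw [← hs]
  exact hε _

end Sign

/-! ### The action of L on its nilradical and on the abelianization -/

/-- An embedding of the model nilpotent superalgebra onto the nilradical, together with the action
of the whole superalgebra on it. -/
structure NilradicalModel {V : Type u} [AddCommGroup V] [Module ℂ V] (A : LieSuperalgebra V)
    {k p : ℕ} (n : Fin k → ℕ) (m : Fin p → ℕ) where
  φ : (NIdx n m →₀ ℂ) →ₗ[ℂ] V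
  injective : Function.Injective φ
  map_bracket : ∀ a b, φ ((modelN n m).bracket a b) = A.bracket (φ a) (φ b)
  mem_part_iff : ∀ i a, φ a ∈ A.part i ↔ a ∈ (modelN n m).part i
  range_eq : LinearMap.range φ = A.nilradical
  act : V →ₗ[ℂ] End ℂ (NIdx n m →₀ ℂ)
  map_act : ∀ v a, φ (act v a) = A.bracket v (φ a)

section

variable {V : Type u} [AddCommGroup V] [Module ℂ V] {A : LieSuperalgebra V}
  {k p : ℕ} {n : Fin k → ℕ} {m : Fin p → ℕ}

theorem nonempty_nilradicalModel
    (h : IsIsomorphic (A.ofIdeal A.nilradical A.nilradical_isIdeal) (modelN n m)) :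
    Nonempty (NilradicalModel A n m) := by
  obtain ⟨e, hpart, hbr⟩ := h
  let φ : (NIdx n m →₀ ℂ) →ₗ[ℂ] V := A.nilradical.subtype ∘ₗ e.symm.toLinearMap
  have hφ : ∀ x : A.nilradical, φ (e x) = x := fun x => by simp [φ]
  have hinj : Function.Injective φ := A.nilradical.injective_subtype.comp e.symm.injective
  have hmem : ∀ v a, A.bracket v (φ a) ∈ A.nilradical := fun v a =>
    A.nilradical_isIdeal.left v _ (e.symm a).2
  let act : V →ₗ[ℂ] (NIdx n m →₀ ℂ) →ₗ[ℂ] (NIdx n m →₀ ℂ) :=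
    LinearMap.mk₂ ℂ (fun v a => e ⟨A.bracket v (φ a), hmem v a⟩)
      (fun v v' a => hinj (by simp [hφ])) (fun c v a => hinj (by simp [hφ]))
      (fun v a a' => hinj (by simp [hφ])) (fun c v a => hinj (by simp [hφ]))
  refine ⟨⟨φ, hinj, fun a b => ?_, fun i a => ?_, ?_, act, fun v a => hφ _⟩⟩
  · have h1 := hbr (e.symm a) (e.symm b)
    rw [e.apply_symm_apply, e.apply_symm_apply] at h1
    rw [← h1, hφ]
    rfl
  · have h1 := hpart i (e.symm a)
    rw [e.apply_symm_apply] at h1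
    exact h1
  · ext x
    constructor
    · rintro ⟨a, rfl⟩
      exact (e.symm a).2
    · intro hx
      exact ⟨e ⟨x, hx⟩, hφ _⟩

namespace NilradicalModel

theorem isNilpotentOn (N : NilradicalModel A n m) : A.IsNilpotentOn A.nilradical := by
  rw [← N.range_eq]
  exact isNilpotentOn_range n m N.φ N.map_bracket

theorem exists_even_add (N : NilradicalModel A n m) (hsq : A.IsNilpotentOn A.square) (v : V) :
    ∃ x ∈ A.part 0, ∃ a, v = x + N.φ a := by
  obtain ⟨x, hx, y, hy, rfl⟩ := A.exists_add_eq v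
  have h := A.odd_le_nilradical hsq N.isNilpotentOn hy
  rw [← N.range_eq] at h
  obtain ⟨a, rfl⟩ := h
  exact ⟨x, hx, a, rfl⟩

variable (N : NilradicalModel A n m)

theorem exists_bracket_eq (hsq : A.IsNilpotentOn A.square) (v w : V) :
    ∃ a, N.φ a = A.bracket v w := by
  have h := A.square_le_nilradical hsq (A.bracket_mem_square v w)
  rw [← N.range_eq] at h
  exact h

theorem act_φ (a b : NIdx n m →₀ ℂ) : N.act (N.φ a) b = (modelN n m).bracket a b :=
  N.injective (by rw [N.map_act, N.map_bracket])

theorem act_derivation {x : V} (hx : x ∈ A.part 0) (a b : NIdx n m →₀ ℂ) :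
    N.act x ((modelN n m).bracket a b) =
      (modelN n m).bracket (N.act x a) b + (modelN n m).bracket a (N.act x b) :=
  N.injective (by
    rw [map_add, N.map_act, N.map_bracket, N.map_bracket, N.map_bracket, N.map_act, N.map_act,
      A.derivation_of_even hx])

theorem act_bracket {x y : V} (hx : x ∈ A.part 0) (hy : y ∈ A.part 0) :
    N.act (A.bracket x y) = N.act x * N.act y - N.act y * N.act x :=
  LinearMap.ext fun a => N.injective (by
    rw [LinearMap.sub_apply, End.mul_apply, End.mul_apply, map_sub, N.map_act, N.map_act, N.map_act,
      N.map_act, N.map_act, A.leibniz_of_even hx hy])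

theorem act_mem_part {x : V} (hx : x ∈ A.part 0) (i : ZMod 2) (a : NIdx n m →₀ ℂ)
    (ha : a ∈ (modelN n m).part i) : N.act x a ∈ (modelN n m).part i := by
  rw [← N.mem_part_iff, N.map_act]
  simpa using A.bracket_mem 0 i _ _ hx ((N.mem_part_iff i a).2 ha)

/-- The induced action on the abelianization of the nilradical. -/
noncomputable def genAct (hn : ∀ j, 1 ≤ n j) (hm : ∀ j, 1 ≤ m j) : V →ₗ[ℂ] End ℂ (TIdx k p → ℂ) where
  toFun v := genCoord hn hm ∘ₗ N.act v ∘ₗ genLift hn hm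
  map_add' v w := by ext; simp
  map_smul' c v := by ext; simp

variable (hn : ∀ j, 1 ≤ n j) (hm : ∀ j, 1 ≤ m j)

theorem genAct_apply (v : V) (w : TIdx k p → ℂ) :
    N.genAct hn hm v w = genCoord hn hm (N.act v (genLift hn hm w)) := rfl

theorem genAct_φ (a : NIdx n m →₀ ℂ) : N.genAct hn hm (N.φ a) = 0 := by
  refine LinearMap.ext fun w => ?_
  rw [genAct_apply, act_φ, genCoord_bracket, LinearMap.zero_apply]

/-- The choice of section in `genAct` does not matter: two lifts differ by an element [x_1, b], and
an even derivation sends brackets to sums of brackets, which vanish in the abelianization. -/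
theorem genCoord_act_of_even {x : V} (hx : x ∈ A.part 0) (a : NIdx n m →₀ ℂ) :
    genCoord hn hm (N.act x a) = N.genAct hn hm x (genCoord hn hm a) := by
  obtain ⟨b, hb⟩ := mem_range_shiftMap hn hm (f := a - genLift hn hm (genCoord hn hm a))
    (by rw [map_sub, genCoord_genLift, sub_self])
  have h1 : shiftMap n m b = (modelN n m).bracket (Finsupp.single .x1 1) b := by
    rw [modelN_bracket, map_sub, map_smul, map_smul, shiftMap_single]
    simp [shift]
  have h2 : genCoord hn hm (N.act x (a - genLift hn hm (genCoord hn hm a))) = 0 := by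
    rw [← hb, h1, N.act_derivation hx, map_add, genCoord_bracket, genCoord_bracket, add_zero]
  rw [map_sub, map_sub, sub_eq_zero] at h2
  exact h2

/-- Modulo N both elements are even, and their commutator acts as [x,y] ∈ L² ⊆ N, that is, by zero
on N/N². -/
theorem genAct_commute (hsq : A.IsNilpotentOn A.square) (v w : V) :
    Commute (N.genAct hn hm v) (N.genAct hn hm w) := by
  obtain ⟨x, hx, a, rfl⟩ := N.exists_even_add hsq v
  obtain ⟨y, hy, b, rfl⟩ := N.exists_even_add hsq w
  rw [map_add, map_add, genAct_φ, genAct_φ, add_zero, add_zero]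
  obtain ⟨c, hc⟩ := N.exists_bracket_eq hsq x y
  refine LinearMap.ext fun z => ?_
  obtain ⟨d, rfl⟩ := genCoord_surjective hn hm z
  rw [End.mul_apply, End.mul_apply, ← genCoord_act_of_even _ _ _ hx,
    ← genCoord_act_of_even _ _ _ hy, ← genCoord_act_of_even _ _ _ hx,
    ← genCoord_act_of_even _ _ _ hy, ← sub_eq_zero, ← map_sub]
  have h := LinearMap.congr_fun (N.act_bracket hx hy) d
  rw [LinearMap.sub_apply, End.mul_apply, End.mul_apply, ← hc, act_φ] at h
  rw [← h, genCoord_bracket]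

/-- For an even representative x, the generalized 0-eigenspace in N is a subalgebra, and it maps
onto N/N² because generalized eigenvectors lift. So it is all of N, x acts nilpotently on N, and x
can be adjoined to the nilradical. -/
theorem mem_range_of_isNilpotent (hsq : A.IsNilpotentOn A.square) {v : V}
    (hv : IsNilpotent (N.genAct hn hm v)) : v ∈ LinearMap.range N.φ := by
  obtain ⟨x, hx, a, rfl⟩ := N.exists_even_add hsq v
  refine Submodule.add_mem _ ?_ ⟨a, rfl⟩
  rw [map_add, genAct_φ, add_zero] at hv
  obtain ⟨q, hq⟩ := hv
  have htop : (N.act x).maxGenEigenspace 0 = ⊤ := by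
    refine eq_top_of_genCoord hn hm (fun a ha b hb => ?_) ?_
    · simpa using derivation_mem_maxGenEigenspace _ (N.act_derivation hx) ha hb
    · rw [eq_top_iff]
      intro w _
      exact exists_mem_maxGenEigenspace_of_surjective (genCoord_surjective hn hm)
        (N.genCoord_act_of_even hn hm hx)
        ((End.mem_maxGenEigenspace _ _ _).2 ⟨q, by simp [hq]⟩)
  have hpow := pow_finrank_eq_zero_of_maxGenEigenspace htop
  rw [N.range_eq]
  refine mem_nilradical_of_flip_pow_eq_zero A.nilradical_isIdeal N.isNilpotentOn
    (A.square_le_nilradical hsq) hx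
    (Q := finrank ℂ (NIdx n m →₀ ℂ)) ?_
  rw [← N.range_eq]
  rintro _ ⟨a, rfl⟩
  have key : ∀ q, (A.bracket.flip x ^ q) (N.φ a) = (-1 : ℂ) ^ q • N.φ ((N.act x ^ q) a) := by
    intro q
    induction q with
    | zero => simp
    | succ q ih =>
      rw [pow_succ', End.mul_apply, ih, map_smul, LinearMap.flip_apply, A.flip_apply_of_even hx,
        pow_succ' (N.act x), End.mul_apply, N.map_act, pow_succ' (-1 : ℂ)]
      module
  rw [key, hpow, LinearMap.zero_apply, map_zero, smul_zero]

theorem ker_genAct (hsq : A.IsNilpotentOn A.square) :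
    LinearMap.ker (N.genAct hn hm) = LinearMap.range N.φ := by
  ext v
  constructor
  · intro hv
    refine N.mem_range_of_isNilpotent hn hm hsq ⟨1, ?_⟩
    rw [pow_one, LinearMap.mem_ker.1 hv]
  · rintro ⟨a, rfl⟩
    exact N.genAct_φ hn hm a

/-- The kernel of the action on the abelianization is N, so its rank is dim L - dim N. This is at
least the number of torus vectors of SN. -/
theorem card_le_finrank_range [FiniteDimensional ℂ V] (hsq : A.IsNilpotentOn A.square)
    (hdim : finrank ℂ ((NIdx n m ⊕ TIdx k p) →₀ ℂ) ≤ finrank ℂ V) :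
    finrank ℂ (TIdx k p → ℂ) ≤ finrank ℂ (LinearMap.range (N.genAct hn hm)) := by
  have h := LinearMap.finrank_range_add_finrank_ker (N.genAct hn hm)
  rw [N.ker_genAct hn hm hsq, LinearMap.finrank_range_of_inj N.injective,
    Module.finrank_finsupp_self] at h
  rw [Module.finrank_finsupp_self, Fintype.card_sum] at hdim
  rw [Module.finrank_fintype_fun_eq_card]
  omega

/-- When the superalgebra has the largest possible dimension, the abelianization of the nilradical
has a homogeneous basis of common eigenvectors, and all systems of eigenvalues occur. -/
theorem exists_weight_basis [FiniteDimensional ℂ V] (hsq : A.IsNilpotentOn A.square)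
    (hdim : finrank ℂ ((NIdx n m ⊕ TIdx k p) →₀ ℂ) ≤ finrank ℂ V) :
    ∃ (w : Basis (TIdx k p) ℂ (TIdx k p → ℂ)) (χ : V →ₗ[ℂ] (TIdx k p → ℂ)),
      (∀ f, ∃ x ∈ A.part 0, χ x = f) ∧ (∀ v s, N.genAct hn hm v (w s) = χ v s • w s) ∧
      w .t1 .t1 ≠ 0 ∧ ∀ s, genSign k p (w s) = (-1 : ℂ) ^ (tParity s).val • w s := by
  obtain ⟨w, χ, hχ, hw, hcomm⟩ := exists_common_eigenbasis (N.genAct hn hm)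
    (N.genAct_commute hn hm hsq) (fun v hv => by
      have h := N.mem_range_of_isNilpotent hn hm hsq hv
      rwa [← N.ker_genAct hn hm hsq] at h) (N.card_le_finrank_range hn hm hsq hdim)
  -- Even elements preserve parity, so the parity involution commutes with the whole family and
  -- preserves each weight line.
  have hsign : ∀ i, ∃ c : ℂ, genSign k p (w i) = c • w i := by
    refine hcomm _ fun v => ?_
    obtain ⟨x, hx, a, rfl⟩ := N.exists_even_add hsq v
    rw [map_add, genAct_φ, add_zero]
    refine LinearMap.ext fun z => ?_
    obtain ⟨d, rfl⟩ := genCoord_surjective hn hm z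
    have h := LinearMap.congr_fun (commute_signMap (N.act_mem_part hx)).eq d
    rw [End.mul_apply, End.mul_apply] at h
    rw [End.mul_apply, End.mul_apply, ← genCoord_signMap, ← N.genCoord_act_of_even hn hm hx,
      ← N.genCoord_act_of_even hn hm hx, ← genCoord_signMap, h]
  obtain ⟨e, he1, he⟩ := exists_parity_equiv w hsign
  refine ⟨w.reindex e.symm, LinearMap.funLeft ℂ ℂ e ∘ₗ χ, fun f => ?_, fun v s => ?_, ?_, ?_⟩
  · obtain ⟨v, hv⟩ := hχ (fun i => f (e.symm i))
    obtain ⟨x, hx, a, rfl⟩ := N.exists_even_add hsq v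
    refine ⟨x, hx, ?_⟩
    ext s
    have h1 := hw x (e s)
    have h2 := hw (x + N.φ a) (e s)
    rw [map_add, genAct_φ, add_zero, h1, hv] at h2
    have h3 := smul_left_injective ℂ (w.ne_zero (e s)) h2
    simpa [LinearMap.funLeft] using h3
  · simpa [LinearMap.funLeft] using hw v (e s)
  · simpa using he1
  · simpa using he

end NilradicalModel

end

end ModelNilpotent

/-! ### The generic element, the torus, and the isomorphism -/

namespace ModelNilpotent

open LieSuperalgebra Module

variable {k p : ℕ} {n : Fin k → ℕ} {m : Fin p → ℕ}

/-- A numbering of the generators that starts with `0` at `t1`. -/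
def tNumber : TIdx k p → ℕ
  | .t1 => 0
  | .t j => 2 * j.val + 1
  | .t' j => 2 * j.val + 2

theorem tNumber_injective : Function.Injective (tNumber : TIdx k p → ℕ) := by
  rintro (_ | j | j) (_ | j' | j') h <;> simp only [tNumber] at h
  · rfl
  · omega
  · omega
  · omega
  · rw [Fin.ext (show j.val = j'.val by omega)]
  · omega
  · omega
  · omega
  · rw [Fin.ext (show j.val = j'.val by omega)]

/-- Homogeneous generalized eigenvectors lift to homogeneous generalized eigenvectors of an even
endomorphism. -/
theorem exists_homogeneous_lift (hn : ∀ j, 1 ≤ n j) (hm : ∀ j, 1 ≤ m j)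
    {D : End ℂ (NIdx n m →₀ ℂ)} (hD : ∀ i, ∀ f ∈ (modelN n m).part i, D f ∈ (modelN n m).part i)
    {M : End ℂ (TIdx k p → ℂ)} (hM : ∀ a, genCoord hn hm (D a) = M (genCoord hn hm a)) {μ : ℂ}
    {w : TIdx k p → ℂ} (hw : M w = μ • w) {i : ZMod 2} (hi : genSign k p w = (-1 : ℂ) ^ i.val • w) :
    ∃ x ∈ D.maxGenEigenspace μ, x ∈ (modelN n m).part i ∧ genCoord hn hm x = w := by
  obtain ⟨x, hx, hxw⟩ := exists_mem_maxGenEigenspace_of_surjective (genCoord_surjective hn hm) hM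
    (μ := μ) (w := w) ((End.mem_maxGenEigenspace _ _ _).2 ⟨1, by simp [hw]⟩)
  have hs : ((-1 : ℂ) ^ i.val) * (-1) ^ i.val = 1 := by rw [← mul_pow]; simp
  -- Project onto the part of parity i by averaging with the parity involution, which commutes with
  -- D and hence preserves the generalized eigenspace.
  refine ⟨(2⁻¹ : ℂ) • (x + (-1 : ℂ) ^ i.val • signMap n m x), ?_, ?_, ?_⟩
  · refine Submodule.smul_mem _ _ (Submodule.add_mem _ hx (Submodule.smul_mem _ _ ?_))
    exact End.mapsTo_maxGenEigenspace_of_comm (commute_signMap hD).symm _ hx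
  · refine mem_part_of_signMap ?_
    have e : (-1 : ℂ) ^ i.val • (x + (-1 : ℂ) ^ i.val • signMap n m x) =
        signMap n m x + (-1 : ℂ) ^ i.val • x := by
      rw [smul_add, smul_smul, hs, one_smul, add_comm]
    rw [map_smul, map_add, map_smul, signMap_signMap, smul_comm ((-1 : ℂ) ^ i.val), e]
  · rw [map_smul, map_add, map_smul, genCoord_signMap, hxw, hi, smul_smul, hs, one_smul]
    module

section

variable {V : Type u} [AddCommGroup V] [Module ℂ V] {A : LieSuperalgebra V}

namespace NilradicalModel

variable (N : NilradicalModel A n m) {hn : ∀ j, 1 ≤ n j} {hm : ∀ j, 1 ≤ m j}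

/-- A homogeneous generic system of generators for the action of an even element, which realizes
a basis of weight vectors of the abelianization. -/
theorem exists_genericSystem [FiniteDimensional ℂ V] (hsq : A.IsNilpotentOn A.square)
    (hdim : finrank ℂ ((NIdx n m ⊕ TIdx k p) →₀ ℂ) ≤ finrank ℂ V) :
    ∃ (w : Basis (TIdx k p) ℂ (TIdx k p → ℂ)) (χ : V →ₗ[ℂ] (TIdx k p → ℂ)) (h : V)
      (c : TIdx k p → ℕ) (u : TIdx k p → NIdx n m →₀ ℂ),
      (∀ f, ∃ x ∈ A.part 0, χ x = f) ∧ (∀ v s, N.genAct hn hm v (w s) = χ v s • w s) ∧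
      h ∈ A.part 0 ∧ IsGenericSystem hn hm (N.act h) c u ∧
      (∀ s, u s ∈ (modelN n m).part (tParity s)) ∧ (∀ s, genCoord hn hm (u s) = w s) ∧
      HasLengths n m u := by
  obtain ⟨w, χ, hχ, hw, hw1, hsign⟩ := N.exists_weight_basis hn hm hsq hdim
  classical
  -- Real parts will count steps along a chain and imaginary parts will label the chains.
  let ev : TIdx k p → ℂ := fun s => if s = .t1 then 1 else tNumber s * Complex.I
  obtain ⟨h, hh, hχh⟩ := hχ ev
  have hlift : ∀ s, ∃ x ∈ (N.act h).maxGenEigenspace (ev s), x ∈ (modelN n m).part (tParity s) ∧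
      genCoord hn hm x = w s := fun s =>
    exists_homogeneous_lift hn hm (N.act_mem_part hh) (N.genCoord_act_of_even hn hm hh)
      (by rw [hw, hχh]) (hsign s)
  choose u hu1 hu2 hu3 using hlift
  have hsys : IsGenericSystem hn hm (N.act h) tNumber u :=
    { derivation := N.act_derivation hh
      injective := tNumber_injective
      zero := rfl
      mem_t1 := by simpa [ev] using hu1 .t1
      mem := fun s hs => by simpa [ev, hs] using hu1 s
      x1_ne_zero := by
        have h1 := congrFun (hu3 .t1) .t1
        rw [genCoord_apply] at h1
        rw [← h1] at hw1
        exact hw1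
      ne_zero := fun s hs => w.ne_zero s (by rw [← hu3, hs, map_zero])
      span := by simp only [hu3, w.span_eq] }
  obtain ⟨σ, hσ1, hσ, hlen⟩ := hsys.exists_perm hu2
  refine ⟨w.reindex σ.symm, LinearMap.funLeft ℂ ℂ σ ∘ₗ χ, h, _, u ∘ σ, fun f => ?_, fun v s => ?_,
    hh, hsys.comp_perm hσ1, fun s => ?_, fun s => ?_, hlen⟩
  · obtain ⟨x, hx, hxf⟩ := hχ (fun i => f (σ.symm i))
    refine ⟨x, hx, ?_⟩
    ext s
    simp [LinearMap.funLeft, hxf]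
  · simpa [LinearMap.funLeft] using hw v (σ s)
  · rw [← hσ]
    exact hu2 _
  · simpa using hu3 (σ s)

/-- Even elements that commute with `h`, pairwise commute, and act on the generators with the
weights of the standard torus. -/
theorem exists_torus (hsq : A.IsNilpotentOn A.square) {w : Basis (TIdx k p) ℂ (TIdx k p → ℂ)}
    {χ : V →ₗ[ℂ] (TIdx k p → ℂ)} {h : V} {c : TIdx k p → ℕ} {u : TIdx k p → NIdx n m →₀ ℂ}
    (hχ : ∀ f, ∃ x ∈ A.part 0, χ x = f) (hw : ∀ v s, N.genAct hn hm v (w s) = χ v s • w s)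
    (hh : h ∈ A.part 0) (hsys : IsGenericSystem hn hm (N.act h) c u)
    (huw : ∀ s, genCoord hn hm (u s) = w s) (hlen : HasLengths n m u) :
    ∃ t : TIdx k p → V, (∀ s, t s ∈ A.part 0) ∧ (∀ s s', A.bracket (t s) (t s') = 0) ∧
      ∀ s s', N.act (t s) (u s') = weight n m s (gen hn hm s') • u s' := by
  have hinj : Function.Injective (N.act h) :=
    (injective_iff_map_eq_zero _).2 fun v hv => hsys.eq_zero_of_apply_eq_zero hlen hv
  have hsurj : Function.Surjective (N.act h) := LinearMap.injective_iff_surjective.1 hinj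
  have hex : ∀ s, ∃ t ∈ A.part 0, A.bracket h t = 0 ∧
      ∀ s', N.genAct hn hm t (w s') = weight n m s (gen hn hm s') • w s' := by
    intro s
    obtain ⟨x, hx, hxs⟩ := hχ fun s' => weight n m s (gen hn hm s')
    obtain ⟨a, ha⟩ := N.exists_bracket_eq hsq h x
    have ha0 : a ∈ (modelN n m).part 0 := by
      rw [← N.mem_part_iff, ha]
      simpa using A.bracket_mem 0 0 _ _ hh hx
    obtain ⟨b, hb⟩ := hsurj a
    obtain ⟨b0, hb0, b1, hb1, rfl⟩ := (modelN n m).exists_add_eq b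
    rw [map_add] at hb
    -- The odd component of b contributes nothing: `act h` preserves parity and a is even. So b may
    -- be replaced by its even component.
    have h1 : N.act h b1 = 0 := by
      refine Submodule.disjoint_def.1 (modelN n m).isCompl.disjoint _ ?_
        (N.act_mem_part hh 1 b1 hb1)
      rw [← eq_sub_iff_add_eq'] at hb
      rw [hb]
      exact Submodule.sub_mem _ ha0 (N.act_mem_part hh 0 b0 hb0)
    rw [h1, add_zero] at hb
    -- Subtracting the preimage of [h,x] under ad h makes x commute with h. The action on the
    -- abelianization does not change, since N acts there by zero.
    refine ⟨x - N.φ b0, Submodule.sub_mem _ hx ((N.mem_part_iff 0 b0).2 hb0), ?_, fun s' => ?_⟩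
    · rw [map_sub, ← ha, ← N.map_act, hb, sub_self]
    · rw [map_sub, genAct_φ, sub_zero, hw, hxs]
  choose t ht0 htc htw using hex
  refine ⟨t, ht0, fun s s' => ?_, fun s s' => ?_⟩
  · obtain ⟨a, ha⟩ := N.exists_bracket_eq hsq (t s) (t s')
    -- The bracket of two torus elements lies in N and is killed by ad h, which is injective on N.
    have h1 := A.derivation_of_even hh (t s) (t s')
    rw [htc, htc, map_zero, map_zero, LinearMap.zero_apply, add_zero, ← ha, ← N.map_act,
      map_eq_zero_iff _ N.injective] at h1
    rw [← ha, hsys.eq_zero_of_apply_eq_zero hlen h1, map_zero]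
  · have hcomm : Commute (N.act h) (N.act (t s)) := by
      have h1 := N.act_bracket hh (ht0 s)
      rw [htc, map_zero] at h1
      exact sub_eq_zero.1 h1.symm
    -- Commuting with ad h makes `t s` scalar on `u s'` itself. The scalar can be read off in the
    -- abelianization.
    obtain ⟨r, hr⟩ := hsys.exists_smul_eq hlen hcomm s'
    have h1 := N.genCoord_act_of_even hn hm (ht0 s) (u s')
    rw [hr, map_smul, huw, htw] at h1
    rw [hr, smul_left_injective ℂ (w.ne_zero s') h1]

end NilradicalModel

/-- A solvable extension of the model nilpotent superalgebra of the largest possible dimension is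
the standard one. -/
theorem isIsomorphic_modelSN [FiniteDimensional ℂ V] (hn : ∀ j, 1 ≤ n j) (hm : ∀ j, 1 ≤ m j)
    (hA : IsSolvableExtension n m A)
    (hdim : finrank ℂ ((NIdx n m ⊕ TIdx k p) →₀ ℂ) ≤ finrank ℂ V) :
    IsIsomorphic A (modelSN n m) := by
  obtain ⟨-, hsq, hiso⟩ := hA
  obtain ⟨N⟩ := nonempty_nilradicalModel hiso
  obtain ⟨w, χ, h, c, u, hχ, hw, hh, hsys, hu, huw, hlen⟩ :=
    N.exists_genericSystem (hn := hn) (hm := hm) hsq hdim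
  obtain ⟨t, ht0, htt, htu⟩ := N.exists_torus hsq hχ hw hh hsys huw hlen
  set b := hsys.basis hlen
  have hb : ∀ a, b a = chainFamily n m u a := hsys.basis_apply hlen
  have hbb : ∀ a a', (modelN n m).bracket (b a) (b a') =
      Finsupp.linearCombination ℂ b (nTable n m a a') := by
    intro a a'
    rw [hb, hb, hlen.bracket_chainFamily hsys.bracket_eq_zero, show (b : NIdx n m → _) = _ from funext hb]
  have htb : ∀ s a, N.act (t s) (b a) = weight n m s a • b a := by
    intro s a
    rw [hb]
    exact chainFamily_eigen (N.act_derivation (ht0 s)) s (htu s) a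
  let Φ : NIdx n m ⊕ TIdx k p → V := Sum.elim (fun a => N.φ (b a)) t
  let Ψ : ((NIdx n m ⊕ TIdx k p) →₀ ℂ) →ₗ[ℂ] V := Finsupp.linearCombination ℂ Φ
  have hΨinl : ∀ f : NIdx n m →₀ ℂ, Ψ (f.mapDomain Sum.inl) =
      N.φ (Finsupp.linearCombination ℂ b f) := by
    intro f
    rw [Finsupp.linearCombination_mapDomain, Finsupp.apply_linearCombination]
    rfl
  have htable : ∀ i j, Ψ (snTable n m i j) = A.bracket (Φ i) (Φ j) := by
    rintro (a | s) (a' | s')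
    · rw [snTable, hΨinl, ← hbb, N.map_bracket]
      rfl
    · rw [snTable, map_neg, Finsupp.linearCombination_single]
      show _ = A.bracket (N.φ (b a)) (t s')
      rw [A.flip_apply_of_even (ht0 s'), ← N.map_act, htb, map_smul]
      rfl
    · rw [snTable, Finsupp.linearCombination_single]
      show _ = A.bracket (t s) (N.φ (b a'))
      rw [← N.map_act, htb, map_smul]
      rfl
    · rw [snTable, map_zero]
      exact (htt s s').symm
  have hΨbr : ∀ x y, Ψ ((modelSN n m).bracket x y) = A.bracket (Ψ x) (Ψ y) := by
    intro x y
    induction x using Finsupp.induction_linear with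
    | zero => simp
    | add x x' h1 h2 => simp only [map_add, LinearMap.add_apply, h1, h2]
    | single i r =>
      induction y using Finsupp.induction_linear with
      | zero => simp
      | add y y' h1 h2 => simp only [map_add, h1, h2]
      | single j s =>
        have e : (modelSN n m).bracket (Finsupp.single i r) (Finsupp.single j s) =
          (r * s) • snTable n m i j := tableBracket_single _ _ _ _ _
        rw [e, map_smul, htable, Finsupp.linearCombination_single, Finsupp.linearCombination_single,
          map_smul, map_smul, LinearMap.smul_apply, smul_smul, mul_comm]
  have hΨpart : ∀ i x, x ∈ (modelSN n m).part i → Ψ x ∈ A.part i := by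
    intro i x hx
    refine supported_ind (P := fun x => Ψ x ∈ A.part i) (by simp)
      (fun _ _ h1 h2 => by simpa using Submodule.add_mem _ h1 h2)
      (fun c _ h => by simpa using Submodule.smul_mem _ c h) (fun a ha => ?_) x hx
    rw [Finsupp.linearCombination_single, one_smul]
    rcases a with a | s
    · have hq : nParity n m a = i := ha
      rw [← hq]
      refine (N.mem_part_iff _ _).2 ?_
      rw [hb]
      exact chainFamily_mem_part hu a
    · have hq : 0 = i := ha
      rw [← hq]
      exact ht0 s
  have hgenAct : ∀ s s', N.genAct hn hm (t s) (w s') = weight n m s (gen hn hm s') • w s' := by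
    intro s s'
    rw [← huw, ← N.genCoord_act_of_even hn hm (ht0 s), htu, map_smul]
  have hlin : LinearIndependent ℂ Φ := by
    rw [Fintype.linearIndependent_iff]
    intro g hg
    rw [Fintype.sum_sum_type] at hg
    have e1 : ∑ a, g (.inl a) • Φ (.inl a) = N.φ (∑ a, g (.inl a) • b a) := by
      simp [Φ]
    -- Acting on the abelianization removes the part in N; the weight matrix then shows that the
    -- torus coefficients vanish.
    have hT : (fun s => g (.inr s)) = 0 := by
      refine weight_gen_eq_zero hn hm fun s' => ?_
      have h1 : N.genAct hn hm (N.φ (∑ a, g (.inl a) • b a) + ∑ s, g (.inr s) • t s) (w s') = 0 := by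
        rw [← e1]
        show N.genAct hn hm (_ + ∑ s, g (.inr s) • Φ (.inr s)) (w s') = 0
        rw [hg, map_zero, LinearMap.zero_apply]
      rw [map_add, NilradicalModel.genAct_φ, zero_add, map_sum, LinearMap.sum_apply] at h1
      have h2 : (∑ s, g (.inr s) * weight n m s (gen hn hm s')) • w s' = 0 := by
        rw [Finset.sum_smul, ← h1]
        refine Finset.sum_congr rfl fun s _ => ?_
        rw [map_smul, LinearMap.smul_apply, mul_smul, hgenAct]
      exact (smul_eq_zero.1 h2).resolve_right (w.ne_zero s')
    have hT' : ∀ s, g (.inr s) = 0 := congrFun hT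
    simp only [hT', zero_smul, Finset.sum_const_zero, add_zero] at hg
    rw [e1, map_eq_zero_iff _ N.injective] at hg
    have hN := Fintype.linearIndependent_iff.1 b.linearIndependent _ hg
    rintro (a | s)
    · exact hN a
    · exact hT' s
  have hinj : Function.Injective Ψ := hlin
  have hsurj : Function.Surjective Ψ := by
    intro v
    -- The square weight matrix is injective, hence invertible. So some torus combination has the
    -- same weights as v, and the difference lies in the kernel N.
    let B : (TIdx k p → ℂ) →ₗ[ℂ] (TIdx k p → ℂ) :=
      Fintype.linearCombination ℂ fun s s' => weight n m s (gen hn hm s')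
    have hB : ∀ c s', B c s' = ∑ s, c s * weight n m s (gen hn hm s') := fun c s' => by
      simp [B, Fintype.linearCombination_apply]
    have hBinj : Function.Injective B := (injective_iff_map_eq_zero _).2 fun c hc =>
      weight_gen_eq_zero hn hm fun s' => by rw [← hB, hc]; rfl
    obtain ⟨c, hc⟩ := LinearMap.injective_iff_surjective.1 hBinj (χ v)
    have hv : v - ∑ s, c s • t s ∈ LinearMap.range N.φ := by
      rw [← N.ker_genAct hn hm hsq, LinearMap.mem_ker]
      refine w.ext fun s' => ?_
      rw [map_sub, LinearMap.sub_apply, hw, ← hc, hB, map_sum, LinearMap.sum_apply,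
        LinearMap.zero_apply, sub_eq_zero, Finset.sum_smul]
      refine Finset.sum_congr rfl fun s _ => ?_
      rw [map_smul, LinearMap.smul_apply, mul_smul, hgenAct]
    obtain ⟨a, ha⟩ := hv
    refine ⟨(b.repr a).mapDomain Sum.inl + ∑ s, Finsupp.single (.inr s) (c s), ?_⟩
    rw [map_add, hΨinl, b.linearCombination_repr, ha, map_sum]
    simp [Ψ, Φ]
  let e := LinearEquiv.ofBijective Ψ ⟨hinj, hsurj⟩
  have he : ∀ x, Ψ (e.symm x) = x := e.apply_symm_apply
  refine ⟨e.symm, fun i x => ?_, fun x y => hinj ?_⟩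
  · rw [← mem_part_iff_of_bijective hinj hΨpart, he]
  · rw [hΨbr, he, he, he]

end

end ModelNilpotent

theorem theorem4p1 {k p : ℕ} (n : Fin k → ℕ) (m : Fin p → ℕ)
    (hn : ∀ j, 1 ≤ n j) (hm : ∀ j, 1 ≤ m j)
    {V : Type u} [AddCommGroup V] [Module ℂ V] [FiniteDimensional ℂ V] (L : LieSuperalgebra V)
    (hL : ModelNilpotent.IsSolvableExtension n m L)
    (hmax : ∀ (V' : Type) [AddCommGroup V'] [Module ℂ V'] [FiniteDimensional ℂ V']
      (L' : LieSuperalgebra V'), ModelNilpotent.IsSolvableExtension n m L' →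
        Module.finrank ℂ V' ≤ Module.finrank ℂ V) :
    LieSuperalgebra.IsIsomorphic L (ModelNilpotent.modelSN n m) :=
  -- Maximality is applied to SN itself and gives dim SN ≤ dim L.
  ModelNilpotent.isIsomorphic_modelSN hn hm hL
    (hmax _ _ (ModelNilpotent.modelSN_isSolvableExtension hn hm))
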